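/- **Setting.** Let $P$ be a fine, saturated and sharp commutative monoid and $n\ge 1$ an integer. Let $X$ be a log scheme, locally of finite type over $\mathbb{C}$ (a sheaf of monoids $M_X$ on the small étale site with a homomorphism $\alpha\colon M_X\to\mathcal{O}_X$ that is an isomorphism over $\mathcal{O}_X^\times$), with a Kato chart $X\to \operatorname{Spec}\mathbb{C}[P]$; that is, a morphism over $\mathbb{C}$ together with a lift $P\to M_X(X)$ of $P\to\Gamma(X,\mathcal{O}_X)$ that identifies $M_X$ with the log structure associated with $P\to \mathcal{O}_X$ (so $X$ is fine and saturated). Let $\frac1nP$ be the monoid of formal fractions $p/n$, $p\in P$, which contains $P$ by $p\mapsto (np)/n$. Let $$X_n = X\times_{\operatorname{Spec}\mathbb{C}[P]}\operatorname{Spec}\mathbb{C}[\tfrac1nP],$$ with the log structure pulled back from $\operatorname{Spec}\mathbb{C}[\frac1nP]$, and let $\phi\colon X_n\to X$ be the induced morphism of log schemes. Let $\mu_n(P)$ be the Cartier dual of $\operatorname{coker}(P^{\mathrm{gp}}\to\frac1nP^{\mathrm{gp}})$, so that $\mu_n(P)_{an}=\operatorname{Hom}(\operatorname{coker}(P^{\mathrm{gp}}\to\frac1nP^{\mathrm{gp}}),\mathbb{C}^\times)$.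 A character $\chi$ acts on $\operatorname{Spec}\mathbb{C}[\frac1nP]$ by $q\mapsto\chi(q)q$; this induces an action on the log scheme $X_n$, hence actions on $(X_n)_{an}$ and $(X_n)_{\log}$. Here $Y_{an}$ is the set of $\mathbb{C}$-points with the analytic topology, and $Y_{\log}$ is the Kato–Nakayama space: the set of pairs $(x,c)$ with $x\in Y_{an}$ and $c\colon M_{Y,x}^{\mathrm{gp}}\to S^1$ a homomorphism with $c(f)=f(x)/|f(x)|$ for $f\in\mathcal{O}_{Y,x}^\times$. For a log scheme $Y$ with a chart $Y\to\operatorname{Spec}\mathbb{C}[Q]$, it carries the topology induced by the map $(x,c)\mapsto (x,\,q\mapsto (|q(x)|,c(q)))$ to $Y_{an}\times(\mathbb{R}_{\geq 0}\times S^1)^Q$, where the second factor has the topology of pointwise convergence. **Proposition.** The action of $\mu_n(P)_{an}$ on $(X_n)_{an}$ is a continuous group action, and: 1. the map $\phi_{\log}\colon (X_n)_{\log}\to X_{\log}$ induced by $\phi$ is a principal $\mu_n(P)_{an}$-bundle: it is continuous, the action of $\mu_n(P)_{an}$ on $(X_n)_{\log}$ is continuous and preserves the fibres of $\phi_{\log}$,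 and every point of $X_{\log}$ has an open neighbourhood $V$ for which $\phi_{\log}^{-1}(V)$ is equivariantly homeomorphic over $V$ to $V\times\mu_n(P)_{an}$; 2. the projection $\tau\colon(X_n)_{\log}\to(X_n)_{an}$ is continuous and $\mu_n(P)_{an}$-equivariant; 3. consequently there is a morphism of stacks over topological spaces $$\Phi\colon X_{\log}\longrightarrow [(X_n)_{an}/\mu_n(P)_{an}]$$ such that $\Phi(\mathrm{id}_{X_{\log}})$ is isomorphic, over the identity of $X_{\log}$, to the principal bundle $\phi_{\log}$ together with the equivariant map $\tau$. Here $[(X_n)_{an}/\mu_n(P)_{an}]$ is the quotient stack, whose objects over a space $T$ are the principal $\mu_n(P)_{an}$-bundles $E\to T$ with a $\mu_n(P)_{an}$-equivariant continuous map $E\to (X_n)_{an}$. It is the presentation, in terms of the chart, of the topological $n$-th root stack $\sqrt[n]{X}_{top}$. -/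

import Mathlib

open CategoryTheory Limits AlgebraicGeometry Opposite

universe u w w'

namespace LogKN


section
/-- The congruence whose quotient is the abelianization of a monoid. -/
def abCon (M : Type*) [Monoid M] : Con M :=
  conGen fun x y => ∃ a b : M, x = a * b ∧ y = b * a

instance (M : Type*) [Monoid M] : CommMonoid (abCon M).Quotient where
  mul_comm x y := by
    induction x using Con.induction_on with | _ x
    induction y using Con.induction_on with | _ y
    exact (Con.eq _).2 (ConGen.Rel.of _ _ ⟨x, y, rfl, rfl⟩)

noncomputable instance : (forget₂ CommMonCat.{u} MonCat.{u}).IsRightAdjoint where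
  exists_leftAdjoint := ⟨_, ⟨Adjunction.adjunctionOfEquivLeft
    (G := forget₂ CommMonCat.{u} MonCat.{u})
    (F_obj := fun M => CommMonCat.of (abCon M).Quotient)
    (fun M N =>
      { toFun := fun f => MonCat.ofHom (f.hom.comp (abCon M).mk')
        invFun := fun f => CommMonCat.ofHom ((abCon M).lift f.hom (by
          refine Con.conGen_le.2 ?_
          rintro x y ⟨a, b, rfl, rfl⟩
          change f.hom _ = f.hom _
          rw [map_mul, map_mul]
          exact mul_comm (G := N) _ _))
        left_inv := fun f => by
          apply ConcreteCategory.hom_ext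
          intro x
          induction x using Con.induction_on
          rfl
        right_inv := fun f => by
          apply ConcreteCategory.hom_ext
          intro x
          rfl })
    (fun M N N' g h => rfl)⟩⟩

noncomputable instance : Reflective (forget₂ CommMonCat.{u} MonCat.{u}) where
  L := (forget₂ CommMonCat.{u} MonCat.{u}).leftAdjoint
  adj := Adjunction.ofIsRightAdjoint _

instance : HasColimits CommMonCat.{u} := hasColimits_of_reflective (forget₂ CommMonCat.{u} MonCat.{u})
end


variable (X : Scheme.{0})
instance (X : Scheme.{0}) {U V : X.Etale} (f : U ⟶ V) :
    Etale ((Scheme.Etale.forget X).map f).left :=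
  inferInstanceAs (Etale f.left)

lemma coverPreserving_forget :
    CoverPreserving X.smallEtaleTopology (Scheme.etaleTopology.over X) (Scheme.Etale.forget X) where
  cover_preserve {V S} hS := by
    obtain ⟨ι, Z, f, rfl⟩ := S.exists_eq_ofArrows
    rw [Scheme.ofArrows_mem_smallEtaleTopology_iff] at hS
    rw [GrothendieckTopology.mem_over_iff]
    have h : Presieve.ofArrows _ (fun i => ((Scheme.Etale.forget X).map (f i)).left) ∈
        Scheme.etalePrecoverage ((Scheme.Etale.forget X).obj V).left := by
      refine Scheme.ofArrows_mem_precoverage_iff _ |>.2 ⟨fun x => ?_, fun i => ?_⟩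
      · have hx : x ∈ (Set.univ : Set V.left) := trivial
        rw [← hS] at hx
        obtain ⟨i, hi⟩ := Set.mem_iUnion.1 hx
        exact ⟨i, hi⟩
      · infer_instance
    refine GrothendieckTopology.superset_covering _ ?_ (Precoverage.generate_mem_toGrothendieck h)
    rw [Sieve.generate_le_iff]
    rintro W g ⟨i⟩
    rw [Sieve.overEquiv_iff]
    refine ⟨Z i, f i, Over.homMk (𝟙 _) ?_, Sieve.ofArrows_mk _ _ i, ?_⟩
    · exact (Over.w ((Scheme.Etale.forget X).map (f i))).symm ▸ Category.id_comp _
    · ext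
      exact (Category.id_comp _).symm

instance : (Scheme.Etale.forget X ⋙ Over.forget X).IsContinuous X.smallEtaleTopology Scheme.etaleTopology := by
  have : (Scheme.Etale.forget X).IsContinuous X.smallEtaleTopology (Scheme.etaleTopology.over X) := by
    have : RepresentablyFlat (Scheme.Etale.forget X) := flat_of_preservesFiniteLimits _
    rw [Functor.isContinuous_iff_coverPreserving]
    exact coverPreserving_forget X
  exact Functor.isContinuous_comp _ _ _ (Scheme.etaleTopology.over X) _

noncomputable def gammaEquiv (X : Scheme.{0}) :
    (X ⟶ Spec (CommRingCat.of (Polynomial ℤ))) ≃ Γ(X, ⊤) := Equiv.ofBijective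
    (fun g => (g.appTop.hom ((Scheme.ΓSpecIso (CommRingCat.of (Polynomial ℤ))).inv.hom Polynomial.X) : Γ(X, ⊤))) (by
      have key (φ : CommRingCat.of (Polynomial ℤ) ⟶ Γ(X, ⊤)) :
        (ΓSpec.adjunction.homEquiv X (op (CommRingCat.of (Polynomial ℤ))) φ.op).appTop.hom ((Scheme.ΓSpecIso (CommRingCat.of (Polynomial ℤ))).inv.hom Polynomial.X) = φ.hom Polynomial.X := by
        conv_rhs => rw [← ΓSpecIso_inv_ΓSpec_adjunction_homEquiv φ]
        rfl
      constructor
      · intro g h e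
        obtain ⟨φ, rfl⟩ := (ΓSpec.adjunction.homEquiv X (op (CommRingCat.of (Polynomial ℤ)))).surjective g
        obtain ⟨ψ, rfl⟩ := (ΓSpec.adjunction.homEquiv X (op (CommRingCat.of (Polynomial ℤ)))).surjective h
        have e' := (key φ.unop).symm.trans (e.trans (key ψ.unop))
        congr 1
        apply Quiver.Hom.unop_inj
        apply CommRingCat.hom_ext
        apply Polynomial.ringHom_ext
        · intro n
          exact (map_intCast (φ.unop.hom.comp Polynomial.C) n).trans (map_intCast (ψ.unop.hom.comp Polynomial.C) n).symm
        · exact e'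
      · intro a
        refine ⟨ΓSpec.adjunction.homEquiv X (op (CommRingCat.of (Polynomial ℤ))) (CommRingCat.ofHom (Polynomial.eval₂RingHom (Int.castRingHom Γ(X,⊤)) a)).op, (key _).trans ?_⟩
        simp)

noncomputable def gammaIso : Scheme.Γ.{0} ⋙ forget CommRingCat ≅
    yoneda.obj (Spec (CommRingCat.of (Polynomial ℤ))) :=
  (NatIso.ofComponents (F := yoneda.obj (Spec (CommRingCat.of (Polynomial ℤ)))) (G := Scheme.Γ.{0} ⋙ forget CommRingCat) 
   (fun X => (gammaEquiv X.unop).toIso) (by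
      intro X Y f
      ext g
      dsimp [gammaEquiv, Equiv.toIso]
      rfl)).symm

lemma etale_le : Scheme.etaleTopology.{0} ≤ Scheme.fpqcTopology := by
  refine le_trans ?_ Scheme.fppfTopology_le_fpqcTopology
  refine Precoverage.toGrothendieck_mono ?_
  refine Scheme.precoverage_mono fun X Y f hf ↦ ?_
  exact ⟨inferInstance, inferInstance⟩

noncomputable def etaleFun (X : Scheme.{0}) : X.Etaleᵒᵖ ⥤ CommMonCat.{0} :=
  (Scheme.Etale.forget X ⋙ Over.forget X).op ⋙ Scheme.Γ ⋙ forget₂ CommRingCat CommMonCat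

instance : ReflectsLimitsOfSize.{w', w} (forget CommMonCat.{u}) where
  reflectsLimitsOfShape {J} _ := ⟨fun {K} => ⟨fun {c} hc => by
    have inj (x y : c.pt) (h : ∀ j, (c.π.app j).hom x = (c.π.app j).hom y) : x = y := by
      have : (↾fun _ : PUnit.{u + 1} => x : PUnit.{u+1} ⟶ (forget CommMonCat.{u}).obj c.pt) = ↾fun _ => y :=
        hc.hom_ext fun j => by
          ext ⟨⟩
          exact h j
      exact ConcreteCategory.congr_hom this PUnit.unit
    have fac (s : Cone K) (x : s.pt) (j : J) :
        (c.π.app j).hom (hc.lift ((forget CommMonCat.{u}).mapCone s) x) = (s.π.app j).hom x :=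
      ConcreteCategory.congr_hom (hc.fac ((forget CommMonCat.{u}).mapCone s) j) x
    refine ⟨{ lift := fun s => CommMonCat.ofHom
                { toFun := fun x => hc.lift ((forget CommMonCat.{u}).mapCone s) x
                  map_one' := inj _ _ fun j => by rw [fac, map_one, map_one]
                  map_mul' := fun x y => inj _ _ fun j => by
                    rw [fac, map_mul, map_mul, fac, fac] }
              fac := fun s j => by
                apply ConcreteCategory.hom_ext
                intro x
                exact fac s x j
              uniq := fun s m hm => by
                apply ConcreteCategory.hom_ext
                intro x
                refine inj _ _ fun j => ?_
                refine Eq.trans ?_ (fac s x j).symm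
                rw [← hm j]
                rfl }⟩⟩⟩

lemma isSheaf_etaleFun : Presheaf.IsSheaf X.smallEtaleTopology (etaleFun X) := by
  have h : Presheaf.IsSheaf Scheme.etaleTopology.{0} (Scheme.Γ.{0} ⋙ forget CommRingCat) := by
    rw [Presheaf.isSheaf_of_iso_iff gammaIso, isSheaf_iff_isSheaf_of_type]
    have : Presieve.IsSheaf Scheme.fpqcTopology.{0} (yoneda.obj (Spec (CommRingCat.of (Polynomial ℤ)))) :=
      GrothendieckTopology.Subcanonical.isSheaf_of_isRepresentable _
    exact Presieve.isSheaf_of_le _ etale_le this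
  have h2 : Presheaf.IsSheaf Scheme.etaleTopology.{0} (Scheme.Γ.{0} ⋙ forget₂ CommRingCat CommMonCat) := by
    apply Presheaf.isSheaf_of_isSheaf_comp _ _ (forget CommMonCat)
    exact h
  exact Functor.op_comp_isSheaf (Scheme.Etale.forget X ⋙ Over.forget X) X.smallEtaleTopology Scheme.etaleTopology ⟨_, h2⟩

noncomputable section

variable {X Y : Scheme.{0}}

/-- Base change of an étale `Y`-scheme `V` along `f : X ⟶ Y`: the étale `X`-scheme `V ×_Y X`. -/
def etalePullbackObj (f : X ⟶ Y) (V : Y.Etale) : X.Etale :=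
  Scheme.Etale.mk (pullback.snd V.hom f)

/-- Base change of morphisms of étale `Y`-schemes along `f : X ⟶ Y`. -/
def etalePullbackMap (f : X ⟶ Y) {V W : Y.Etale} (g : V ⟶ W) :
    etalePullbackObj f V ⟶ etalePullbackObj f W :=
  (Scheme.Etale.forgetFullyFaithful X).preimage
    ((Over.pullback f).map ((Scheme.Etale.forget Y).map g))

lemma forget_map_etalePullbackMap (f : X ⟶ Y) {V W : Y.Etale} (g : V ⟶ W) :
    (Scheme.Etale.forget X).map (etalePullbackMap f g) =
      (Over.pullback f).map ((Scheme.Etale.forget Y).map g) :=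
  (Scheme.Etale.forgetFullyFaithful X).map_preimage
    (X := etalePullbackObj f V) (Y := etalePullbackObj f W) _

/-- The base change functor `V ↦ V ×_Y X` on small étale sites along `f : X ⟶ Y`. -/
def etalePullback (f : X ⟶ Y) : Y.Etale ⥤ X.Etale where
  obj V := etalePullbackObj f V
  map g := etalePullbackMap f g
  map_id V := by
    apply (Scheme.Etale.forget X).map_injective
    rw [forget_map_etalePullbackMap, CategoryTheory.Functor.map_id, CategoryTheory.Functor.map_id]
    exact ((Scheme.Etale.forget X).map_id (etalePullbackObj f V)).symm
  map_comp g h := by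
    apply (Scheme.Etale.forget X).map_injective
    rw [forget_map_etalePullbackMap, (Scheme.Etale.forget Y).map_comp,
      (Scheme.Etale.forget X).map_comp, forget_map_etalePullbackMap, forget_map_etalePullbackMap]
    exact (Over.pullback f).map_comp _ _

lemma forget_map_etalePullback_map (f : X ⟶ Y) {V W : Y.Etale} (g : V ⟶ W) :
    (Scheme.Etale.forget X).map ((etalePullback f).map g) =
      (Over.pullback f).map ((Scheme.Etale.forget Y).map g) :=
  forget_map_etalePullbackMap f g

/-- On underlying schemes over the base, `etalePullback` is the fibre product. -/
def etalePullbackIso (f : X ⟶ Y) :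
    etalePullback f ⋙ Scheme.Etale.forget X ≅ Scheme.Etale.forget Y ⋙ Over.pullback f :=
  NatIso.ofComponents (F := etalePullback f ⋙ Scheme.Etale.forget X)
    (G := Scheme.Etale.forget Y ⋙ Over.pullback f)
    (fun V => Iso.refl ((Over.pullback f).obj ((Scheme.Etale.forget Y).obj V))) (fun g =>
    (Category.comp_id _).trans ((forget_map_etalePullback_map f g).trans (Category.id_comp _).symm))

lemma etalePullback_map_left_fst (f : X ⟶ Y) {V W : Y.Etale} (g : V ⟶ W) :
    ((Scheme.Etale.forget X).map ((etalePullback f).map g)).left ≫ pullback.fst W.hom f =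
      pullback.fst V.hom f ≫ ((Scheme.Etale.forget Y).map g).left := by
  rw [forget_map_etalePullback_map]
  exact pullback.lift_fst _ _ _

lemma etalePullback_map_left_snd (f : X ⟶ Y) {V W : Y.Etale} (g : V ⟶ W) :
    ((Scheme.Etale.forget X).map ((etalePullback f).map g)).left ≫ pullback.snd W.hom f =
      pullback.snd V.hom f :=
  Over.w ((Scheme.Etale.forget X).map ((etalePullback f).map g))

lemma etalePullback_isPullback (f : X ⟶ Y) {V W : Y.Etale} (g : V ⟶ W) :
    IsPullback (pullback.fst V.hom f) ((Scheme.Etale.forget X).map ((etalePullback f).map g)).left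
      ((Scheme.Etale.forget Y).map g).left (pullback.fst W.hom f) := by
  have h : ((Scheme.Etale.forget Y).map g).left ≫ W.hom = V.hom :=
    Over.w ((Scheme.Etale.forget Y).map g)
  have h1 : IsPullback (pullback.fst V.hom f) (pullback.snd V.hom f) V.hom f :=
    IsPullback.of_hasPullback V.hom f
  refine IsPullback.of_bot (h₃₁ := f) (v₂₁ := pullback.snd W.hom f) (v₂₂ := W.hom)
    ?_ (etalePullback_map_left_fst f g).symm (IsPullback.of_hasPullback W.hom f)
  exact Eq.subst (motive := fun a => IsPullback (pullback.fst V.hom f) a _ f)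
    (etalePullback_map_left_snd f g).symm
    (Eq.subst (motive := fun a => IsPullback (pullback.fst V.hom f) _ a f) h.symm h1)

instance (f : X ⟶ Y) : PreservesFiniteLimits (etalePullback f) := by
  have : PreservesFiniteLimits (Over.pullback f) := by
    have := (Over.mapPullbackAdj f).isRightAdjoint
    exact inferInstance
  have : PreservesFiniteLimits (Scheme.Etale.forget Y ⋙ Over.pullback f) := inferInstance
  have : PreservesFiniteLimits (etalePullback f ⋙ Scheme.Etale.forget X) :=
    preservesFiniteLimits_of_natIso (etalePullbackIso f).symm
  exact preservesFiniteLimits_of_reflects_of_preserves (etalePullback f) (Scheme.Etale.forget X)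

instance (f : X ⟶ Y) :
    (etalePullback f).IsContinuous Y.smallEtaleTopology X.smallEtaleTopology := by
  have : RepresentablyFlat (etalePullback f) := flat_of_preservesFiniteLimits _
  rw [Functor.isContinuous_iff_coverPreserving]
  refine ⟨fun {V S} hS => ?_⟩
  obtain ⟨ι, Z, g, rfl⟩ := S.exists_eq_ofArrows
  rw [Scheme.ofArrows_mem_smallEtaleTopology_iff] at hS
  have h : Sieve.ofArrows _ (fun i => (etalePullback f).map (g i)) ∈
      X.smallEtaleTopology ((etalePullback f).obj V) := by
    rw [Scheme.ofArrows_mem_smallEtaleTopology_iff]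
    refine Set.eq_univ_of_forall fun (x : ↥(pullback V.hom f)) => ?_
    have hx : pullback.fst V.hom f x ∈ (Set.univ : Set V.left) := trivial
    rw [← hS] at hx
    obtain ⟨i, z, hz⟩ := Set.mem_iUnion.1 hx
    obtain ⟨t, -, ht⟩ :=
      Scheme.exists_preimage_of_isPullback (etalePullback_isPullback f (g i)) z x hz
    exact Set.mem_iUnion.2 ⟨i, t, ht⟩
  refine GrothendieckTopology.superset_covering _ ?_ h
  rw [Sieve.ofArrows, Sieve.generate_le_iff]
  rintro W _ ⟨i⟩
  exact ⟨Z i, g i, 𝟙 _, Sieve.ofArrows_mk _ _ i, (Category.id_comp _).symm⟩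

end

section AssocMonoid

/-- For a homomorphism `a : P → R` of commutative monoids, the congruence on `P × Rˣ` generated by
`(p, 1) ∼ (1, w)` whenever `a p` is the unit `w`. -/
def assocCon {P R : Type*} [CommMonoid P] [CommMonoid R] (a : P →* R) : Con (P × Rˣ) :=
  conGen fun x y => ∃ (p : P) (w : Rˣ), a p = w ∧ x = (p, 1) ∧ y = (1, w)

/-- The pushout `P ⊕_{a⁻¹(Rˣ)} Rˣ` of commutative monoids. -/
abbrev Assoc {P R : Type*} [CommMonoid P] [CommMonoid R] (a : P →* R) : Type _ :=
  (assocCon a).Quotient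

namespace Assoc

variable {P R P' R' P'' R'' : Type*} [CommMonoid P] [CommMonoid R] [CommMonoid P'] [CommMonoid R']
  [CommMonoid P''] [CommMonoid R'']
  (a : P →* R) (a' : P' →* R') (a'' : P'' →* R'')

/-- The class of `(p, u)`, thought of as `p · u`. -/
abbrev mk : P × Rˣ →* Assoc a := (assocCon a).mk'

lemma mk_eq_of_unit (p : P) (w v : Rˣ) (h : a p = w) : mk a (p, v) = mk a (1, w * v) := by
  have h1 : mk a (p, 1) = mk a (1, w) := (Con.eq _).2 (ConGen.Rel.of _ _ ⟨p, w, h, rfl, rfl⟩)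
  have h2 : mk a (p, v) = mk a (p, 1) * mk a (1, v) := by
    rw [← map_mul, Prod.mk_mul_mk, mul_one, one_mul]
  rw [h2, h1, ← map_mul, Prod.mk_mul_mk, mul_one]

/-- The structure map `P ⊕_{a⁻¹(Rˣ)} Rˣ → R`, `(p, u) ↦ a p * u`. -/
def toRing : Assoc a →* R :=
  (assocCon a).lift (a.coprod (Units.coeHom R)) (by
    refine Con.conGen_le.2 ?_
    rintro _ _ ⟨p, w, h, rfl, rfl⟩
    change a p * ((1 : Rˣ) : R) = a 1 * w
    rw [h, map_one, one_mul, Units.val_one, mul_one])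

@[simp] lemma toRing_mk (x : P × Rˣ) : toRing a (mk a x) = a x.1 * x.2 := rfl

/-- Functoriality of the pushout: a homomorphism `θ : P → P'`, a homomorphism `g : R → R'` and
units `u p` of `R'` with `g (a p) = a' (θ p) * u p` induce `(p, v) ↦ (θ p, u p * g v)`. -/
def map (θ : P →* P') (g : R →* R') (u : P →* R'ˣ) (h : ∀ p, g (a p) = a' (θ p) * u p) :
    Assoc a →* Assoc a' :=
  (assocCon a).lift ((mk a').comp ((θ.prod u).coprod
      ((1 : Rˣ →* P').prod (Units.map g)))) (by
    refine Con.conGen_le.2 ?_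
    rintro _ _ ⟨p, w, hw, rfl, rfl⟩
    change mk a' (θ p * 1, u p * Units.map g 1) = mk a' (θ 1 * 1, u 1 * Units.map g w)
    have h' : a' (θ p) = (Units.map g w * (u p)⁻¹ : R'ˣ) := by
      rw [Units.val_mul, Units.eq_mul_inv_iff_mul_eq, ← h, hw]
      rfl
    rw [mul_one, mul_one, map_one, map_one, map_one, mul_one, one_mul, mk_eq_of_unit a' _ _ _ h',
      inv_mul_cancel_right])

@[simp] lemma map_mk (θ : P →* P') (g : R →* R') (u : P →* R'ˣ)
    (h : ∀ p, g (a p) = a' (θ p) * u p) (x : P × Rˣ) :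
    map a a' θ g u h (mk a x) = mk a' (θ x.1, u x.1 * Units.map g x.2) := by
  change mk a' (θ x.1 * 1, u x.1 * Units.map g x.2) = _
  rw [mul_one]

lemma toRing_map (θ : P →* P') (g : R →* R') (u : P →* R'ˣ)
    (h : ∀ p, g (a p) = a' (θ p) * u p) (x : Assoc a) :
    toRing a' (map a a' θ g u h x) = g (toRing a x) := by
  obtain ⟨⟨p, v⟩, rfl⟩ := (assocCon a).mk'_surjective x
  rw [map_mk, toRing_mk, toRing_mk, map_mul, h, mul_assoc]
  rfl

end Assoc

end AssocMonoid

noncomputable section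

variable {X Y : Scheme.{0}}

/-- The ring of functions of an étale `X`-scheme. -/
abbrev etRing (U : X.Etale) : Type := Γ(((Scheme.Etale.forget X).obj U).left, ⊤)

/-- Restriction of functions along a morphism of étale `X`-schemes. -/
abbrev etRes {U V : X.Etale} (g : U ⟶ V) : etRing V →+* etRing U :=
  ((Scheme.Etale.forget X).map g).left.appTop.hom

/-- Restriction of functions on `X` to an étale `X`-scheme. -/
abbrev etOfTop (U : X.Etale) : Γ(X, ⊤) →+* etRing U :=
  ((Scheme.Etale.forget X).obj U).hom.appTop.hom

lemma etRes_etOfTop {U V : X.Etale} (g : U ⟶ V) (s : Γ(X, ⊤)) :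
    etRes g (etOfTop V s) = etOfTop U s := by
  have h : ((Scheme.Etale.forget X).map g).left ≫ ((Scheme.Etale.forget X).obj V).hom =
    ((Scheme.Etale.forget X).obj U).hom := Over.w ((Scheme.Etale.forget X).map g)
  change _ = ((Scheme.Etale.forget X).obj U).hom.appTop s
  rw [← h, Scheme.Hom.comp_appTop]
  rfl

lemma etRes_id (U : X.Etale) : etRes (𝟙 U) = RingHom.id (etRing U) := by
  ext s
  change ((Scheme.Etale.forget X).map (𝟙 U)).left.appTop s = s
  rw [CategoryTheory.Functor.map_id, Over.id_left, Scheme.Hom.id_appTop]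
  rfl

lemma etRes_comp {U V W : X.Etale} (g : U ⟶ V) (h : V ⟶ W) :
    etRes (g ≫ h) = (etRes g).comp (etRes h) := by
  ext s
  change ((Scheme.Etale.forget X).map (g ≫ h)).left.appTop s = _
  rw [CategoryTheory.Functor.map_comp, Over.comp_left, Scheme.Hom.comp_appTop]
  rfl

/-- The map `P → Γ(U)` induced on an étale `X`-scheme by `P → Γ(X)`. -/
def etChart {P : Type} [CommMonoid P] (a : P →* Γ(X, ⊤)) (U : X.Etale) : P →* etRing U :=
  (etOfTop U).toMonoidHom.comp a

lemma etRes_etChart {P : Type} [CommMonoid P] (a : P →* Γ(X, ⊤)) {U V : X.Etale} (g : U ⟶ V)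
    (p : P) : etRes g (etChart a V p) = etChart a U p :=
  etRes_etOfTop g (a p)

/-- Restriction `(p, v) ↦ (p, v|_U)` on presheaf pushouts. -/
def assocRes {P : Type} [CommMonoid P] (a : P →* Γ(X, ⊤)) {U V : X.Etale} (g : U ⟶ V) :
    Assoc (etChart a V) →* Assoc (etChart a U) :=
  Assoc.map (etChart a V) (etChart a U) (MonoidHom.id P) (etRes g).toMonoidHom 1 (fun p => by
    rw [MonoidHom.one_apply, Units.val_one, mul_one]
    exact etRes_etChart a g p)

lemma assocRes_mk {P : Type} [CommMonoid P] (a : P →* Γ(X, ⊤)) {U V : X.Etale} (g : U ⟶ V)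
    (p : P) (v : (etRing V)ˣ) : assocRes a g (Assoc.mk (etChart a V) (p, v)) =
      Assoc.mk (etChart a U) (p, Units.map (etRes g).toMonoidHom v) := by
  refine (Assoc.map_mk _ _ _ _ _ _ _).trans ?_
  rw [MonoidHom.one_apply, one_mul]
  rfl

lemma toRing_assocRes {P : Type} [CommMonoid P] (a : P →* Γ(X, ⊤)) {U V : X.Etale} (g : U ⟶ V)
    (x : Assoc (etChart a V)) :
    Assoc.toRing (etChart a U) (assocRes a g x) = etRes g (Assoc.toRing (etChart a V) x) :=
  Assoc.toRing_map _ _ _ _ _ _ x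

/-- The presheaf pushout of the constant prelog structure `P → O_X` on the small étale site. -/
def assocPresheaf {P : Type} [CommMonoid P] (a : P →* Γ(X, ⊤)) : X.Etaleᵒᵖ ⥤ CommMonCat.{0} where
  obj U := CommMonCat.of (Assoc (etChart a U.unop))
  map {V U} g := CommMonCat.ofHom (assocRes a g.unop)
  map_id V := by
    apply ConcreteCategory.hom_ext
    intro x
    obtain ⟨⟨p, v⟩, rfl⟩ := (assocCon (etChart a V.unop)).mk'_surjective x
    refine (assocRes_mk a _ p v).trans (congrArg (Assoc.mk (etChart a V.unop))
      (Prod.ext rfl (Units.ext ?_)))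
    change etRes (𝟙 V.unop) v = v
    rw [etRes_id, RingHom.id_apply]
  map_comp {V U W} g h := by
    apply ConcreteCategory.hom_ext
    intro x
    obtain ⟨⟨p, v⟩, rfl⟩ := (assocCon (etChart a V.unop)).mk'_surjective x
    refine (assocRes_mk a _ p v).trans (Eq.trans ?_ (congrArg (assocRes a h.unop)
      (assocRes_mk a g.unop p v)).symm)
    refine Eq.trans ?_ (assocRes_mk a h.unop p _).symm
    refine congrArg (Assoc.mk (etChart a W.unop)) (Prod.ext rfl (Units.ext ?_))
    change etRes (h.unop ≫ g.unop) v = etRes h.unop (etRes g.unop v)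
    rw [etRes_comp, RingHom.comp_apply]

/-- The log structure associated with `a : P → Γ(X, O_X)`: the sheaf pushout
`P ⊕_{α⁻¹(O_X^×)} O_X^×` on the small étale site. -/
def assocLog {P : Type} [CommMonoid P] (a : P →* Γ(X, ⊤)) : X.Etaleᵒᵖ ⥤ CommMonCat.{0} :=
  sheafify X.smallEtaleTopology (assocPresheaf a)

lemma assocLog_isSheaf {P : Type} [CommMonoid P] (a : P →* Γ(X, ⊤)) :
    Presheaf.IsSheaf X.smallEtaleTopology (assocLog a) :=
  ((presheafToSheaf X.smallEtaleTopology CommMonCat.{0}).obj (assocPresheaf a)).2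

/-- The canonical map from the presheaf pushout. -/
def toAssocLog {P : Type} [CommMonoid P] (a : P →* Γ(X, ⊤)) : assocPresheaf a ⟶ assocLog a :=
  toSheafify X.smallEtaleTopology (assocPresheaf a)

/-- The map `(p, u) ↦ a p * u` from the presheaf pushout to functions. -/
def assocPresheafToFun {P : Type} [CommMonoid P] (a : P →* Γ(X, ⊤)) :
    assocPresheaf a ⟶ etaleFun X where
  app U := CommMonCat.ofHom (Assoc.toRing (etChart a U.unop))
  naturality V U g := by
    apply ConcreteCategory.hom_ext
    intro x
    exact toRing_assocRes a g.unop x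

/-- The structure map of the associated log structure. -/
def assocLogToFun {P : Type} [CommMonoid P] (a : P →* Γ(X, ⊤)) : assocLog a ⟶ etaleFun X :=
  sheafifyLift X.smallEtaleTopology (assocPresheafToFun a) (isSheaf_etaleFun X)

lemma toAssocLog_toFun {P : Type} [CommMonoid P] (a : P →* Γ(X, ⊤)) :
    toAssocLog a ≫ assocLogToFun a = assocPresheafToFun a :=
  toSheafify_sheafifyLift _ _ _

lemma assocLog_local {P : Type} [CommMonoid P] (a : P →* Γ(X, ⊤)) (U : X.Etale)
    (m : (assocLog a).obj (op U)) :
    Presheaf.imageSieve (toAssocLog a) m ∈ X.smallEtaleTopology U :=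
  have : Presheaf.IsLocallySurjective X.smallEtaleTopology (toAssocLog a) :=
    inferInstanceAs (Presheaf.IsLocallySurjective _ (toSheafify _ _))
  Presheaf.imageSieve_mem X.smallEtaleTopology (toAssocLog a) (U := op U) m

lemma sheaf_ext {M : X.Etaleᵒᵖ ⥤ CommMonCat.{0}} (hM : Presheaf.IsSheaf X.smallEtaleTopology M)
    {U : X.Etale} (S : Sieve U) (hS : S ∈ X.smallEtaleTopology U) (m m' : M.obj (op U))
    (h : ∀ (V : X.Etale) (g : V ⟶ U), S g → M.map g.op m = M.map g.op m') : m = m' := by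
  have h1 : Presheaf.IsSheaf X.smallEtaleTopology (M ⋙ forget CommMonCat.{0}) :=
    (sheafCompose X.smallEtaleTopology (forget CommMonCat.{0})).obj ⟨M, hM⟩ |>.2
  rw [isSheaf_iff_isSheaf_of_type] at h1
  exact (h1 S hS).isSeparatedFor.ext fun V g hg => h V g hg

lemma assocLog_units {P : Type} [CommMonoid P] (a : P →* Γ(X, ⊤)) (U : X.Etale) (s : etRing U)
    (hs : IsUnit s) : ∃! m : (assocLog a).obj (op U), (assocLogToFun a).app (op U) m = s := by
  obtain ⟨v, rfl⟩ := hs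
  have key (V : X.Etale) (x : Assoc (etChart a V)) : (assocLogToFun a).app (op V)
      ((toAssocLog a).app (op V) x) = Assoc.toRing (etChart a V) x :=
    ConcreteCategory.congr_hom (NatTrans.congr_app (toAssocLog_toFun a) (op V)) x
  refine ⟨(toAssocLog a).app (op U) (Assoc.mk (etChart a U) (1, v)), ?_, fun m hm => ?_⟩
  · change (assocLogToFun a).app (op U) _ = _
    rw [key, Assoc.toRing_mk, map_one, one_mul]
  · refine sheaf_ext (assocLog_isSheaf a) _ (assocLog_local a U m) _ _ fun V g ⟨x, hx⟩ => ?_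
    obtain ⟨⟨p, w⟩, rfl⟩ := (assocCon (etChart a V)).mk'_surjective x
    have e1 : (assocLogToFun a).app (op V) ((assocLog a).map g.op m) = etRes g v := by
      rw [NatTrans.naturality_apply, hm]
      rfl
    rw [← hx] at e1
    replace e1 : etChart a V p * w = etRes g v := (key V _).symm.trans e1
    rw [← hx]
    refine Eq.trans (congrArg ((toAssocLog a).app (op V)).hom ?_)
      (NatTrans.naturality_apply (toAssocLog a) g.op (Assoc.mk (etChart a U) (1, v)))
    refine Eq.trans ?_ (assocRes_mk a g 1 v).symm
    have e2 : etChart a V p = (Units.map (etRes g).toMonoidHom v * w⁻¹ : (etRing V)ˣ) := by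
      rw [Units.val_mul, Units.eq_mul_inv_iff_mul_eq, e1]
      rfl
    refine (Assoc.mk_eq_of_unit _ _ _ _ e2).trans (congrArg _ (Prod.ext rfl (Units.ext ?_)))
    change (Units.map (etRes g).toMonoidHom v * w⁻¹ * w : (etRing V)ˣ).1 = etRes g v
    rw [inv_mul_cancel_right]
    rfl

/-- Pullback of functions along `f`, as a map of sheaves of monoids on the small étale site. -/
def etaleFunPullback (f : X ⟶ Y) : etaleFun Y ⟶ (etalePullback f).op ⋙ etaleFun X where
  app V := (forget₂ CommRingCat CommMonCat).map (pullback.fst V.unop.hom f).appTop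
  naturality V W g := by
    have h := etalePullback_map_left_fst f g.unop
    have h2 := (Scheme.Hom.comp_appTop _ _).symm.trans (congrArg Scheme.Hom.appTop h)
    have h3 := h2.trans (Scheme.Hom.comp_appTop _ _)
    exact congrArg (forget₂ CommRingCat CommMonCat).map h3.symm

end

noncomputable section

/-- A log scheme over `ℂ`: a sheaf of commutative monoids `M` on the small étale site with a
homomorphism `α` to the multiplicative sheaf of functions, which is an isomorphism over the sheaf
of units. -/
structure LogScheme where
  X : Scheme.{0}
  str : X ⟶ Spec (CommRingCat.of ℂ)
  M : X.Etaleᵒᵖ ⥤ CommMonCat.{0}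
  isSheaf : Presheaf.IsSheaf X.smallEtaleTopology M
  α : M ⟶ etaleFun X
  units : ∀ (U : X.Etale) (s : etRing U), IsUnit s → ∃! m : M.obj (op U), α.app (op U) m = s

/-- The value of a function at a `ℂ`-point. -/
def evalAt {U : Scheme.{0}} (u : Spec (CommRingCat.of ℂ) ⟶ U) : Γ(U, ⊤) →+* ℂ :=
  (Scheme.ΓSpecIso (CommRingCat.of ℂ)).hom.hom.comp u.appTop.hom

lemma evalAt_comp {U V : Scheme.{0}} (u : Spec (CommRingCat.of ℂ) ⟶ U) (g : U ⟶ V)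
    (s : Γ(V, ⊤)) : evalAt (u ≫ g) s = evalAt u (g.appTop.hom s) := by
  change (Scheme.ΓSpecIso (CommRingCat.of ℂ)).hom.hom ((u ≫ g).appTop.hom s) = _
  rw [Scheme.Hom.comp_appTop]
  rfl

/-- The set of `ℂ`-points of a scheme over `ℂ`. -/
@[ext] structure CPoint {X : Scheme.{0}} (s : X ⟶ Spec (CommRingCat.of ℂ)) : Type where
  hom : Spec (CommRingCat.of ℂ) ⟶ X
  isOver : hom ≫ s = 𝟙 _

/-- The analytic topology on `ℂ`-points: the coarsest one for which, for every Zariski open `U` and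
every function `h` on `U`, the set `U(ℂ)` is open and `h` is continuous on it. -/
instance {X : Scheme.{0}} (s : X ⟶ Spec (CommRingCat.of ℂ)) : TopologicalSpace (CPoint s) :=
  TopologicalSpace.generateFrom
    {S | ∃ (U : X.Opens) (h : Γ((U : Scheme.{0}), ⊤)) (D : Set ℂ), IsOpen D ∧
      S = {x | ∃ u : Spec (CommRingCat.of ℂ) ⟶ (U : Scheme.{0}), u ≫ U.ι = x.hom ∧ evalAt u h ∈ D}}

namespace LogScheme

variable (L : LogScheme)

/-- The space `X_an`. -/
abbrev An : Type := CPoint L.str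

/-- The section of `M` given by an invertible function. -/
def unitSec (U : L.X.Etale) : (etRing U)ˣ →* L.M.obj (op U) where
  toFun v := (L.units U v v.isUnit).choose
  map_one' := (L.units U (1 : (etRing U)ˣ) (Units.isUnit _)).unique
    (L.units U (1 : (etRing U)ˣ) (Units.isUnit _)).choose_spec.1 (map_one _)
  map_mul' v w := (L.units U (v * w : (etRing U)ˣ) (Units.isUnit _)).unique
    (L.units U (v * w : (etRing U)ˣ) (Units.isUnit _)).choose_spec.1
    ((map_mul (L.α.app (op U)).hom _ _).trans (congrArg₂ (fun a b : etRing U => a * b)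
      (L.units U v v.isUnit).choose_spec.1 (L.units U w w.isUnit).choose_spec.1))

lemma α_unitSec (U : L.X.Etale) (v : (etRing U)ˣ) :
    L.α.app (op U) (L.unitSec U v) = (v : etRing U) :=
  (L.units U v v.isUnit).choose_spec.1

lemma eq_unitSec (U : L.X.Etale) (v : (etRing U)ˣ) (m : L.M.obj (op U))
    (h : L.α.app (op U) m = (v : etRing U)) : m = L.unitSec U v :=
  (L.units U v v.isUnit).unique h (L.α_unitSec U v)

/-- The geometric point of the small étale site defined by a `ℂ`-point. -/
abbrev geomPoint (x : Spec (CommRingCat.of ℂ) ⟶ L.X) : L.X.smallEtaleTopology.Point :=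
  Scheme.pointSmallEtale (S := L.X) (Ω := ℂ) x

/-- The `ℂ`-points of the étale scheme `U` over the `ℂ`-point `x`. -/
abbrev Lift (x : Spec (CommRingCat.of ℂ) ⟶ L.X) (U : L.X.Etale) : Type :=
  Over.mk x ⟶ (Scheme.Etale.forget L.X).obj U

/-- The stalk of `M` at a geometric point. -/
def stalk (x : Spec (CommRingCat.of ℂ) ⟶ L.X) : CommMonCat.{0} :=
  (L.geomPoint x).presheafFiber.obj L.M

/-- The germ of a section at a point of an étale scheme. -/
def germ (x : Spec (CommRingCat.of ℂ) ⟶ L.X) {U : L.X.Etale} (u : L.Lift x U) :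
    L.M.obj (op U) →* L.stalk x :=
  ((L.geomPoint x).toPresheafFiber U u L.M).hom

/-- A point of the Kato–Nakayama space: a `ℂ`-point `x` together with a homomorphism
`c : M_x^gp → S¹` such that `c(v) = v(x)/|v(x)|` for all units `v`. -/
structure KNPoint where
  pt : L.An
  c : Algebra.GrothendieckGroup (L.stalk pt.hom) →* Circle
  norm : ∀ (U : L.X.Etale) (u : L.Lift pt.hom U) (v : (etRing U)ˣ),
    (c (Algebra.GrothendieckGroup.of (L.germ pt.hom u (L.unitSec U v))) : ℂ) =
      evalAt u.left v.1 / ‖evalAt u.left v.1‖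

end LogScheme

/-- A morphism of log schemes over `ℂ`. -/
structure LogHom (K L : LogScheme) where
  f : K.X ⟶ L.X
  w : f ≫ L.str = K.str
  φ : L.M ⟶ (etalePullback f).op ⋙ K.M
  comm : φ ≫ Functor.whiskerLeft (etalePullback f).op K.α = L.α ≫ etaleFunPullback f

namespace LogHom

variable {K L : LogScheme} (F : LogHom K L)

/-- The map on `ℂ`-points. -/
def mapAn (x : K.An) : L.An :=
  ⟨x.hom ≫ F.f, by rw [Category.assoc, F.w, x.isOver]⟩

/-- The point of `V ×_Y X` over `x` defined by a point of `V` over the image of `x`. -/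
def liftPt (x : Spec (CommRingCat.of ℂ) ⟶ K.X) {V : L.X.Etale} (v : L.Lift (x ≫ F.f) V) :
    K.Lift x ((etalePullback F.f).obj V) :=
  Over.homMk (pullback.lift v.left x (Over.w v)) (pullback.lift_snd _ _ _)

lemma liftPt_left_fst (x : Spec (CommRingCat.of ℂ) ⟶ K.X) {V : L.X.Etale}
    (v : L.Lift (x ≫ F.f) V) : (F.liftPt x v).left ≫ pullback.fst V.hom F.f = v.left :=
  pullback.lift_fst _ _ _

lemma liftPt_comp (x : Spec (CommRingCat.of ℂ) ⟶ K.X) {V W : L.X.Etale} (g : V ⟶ W)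
    (v : L.Lift (x ≫ F.f) V) :
    F.liftPt x v ≫ (Scheme.Etale.forget K.X).map ((etalePullback F.f).map g) =
      F.liftPt x (v ≫ (Scheme.Etale.forget L.X).map g) := by
  ext
  refine pullback.hom_ext ?_ ?_
  · refine Eq.trans ?_ (F.liftPt_left_fst x (v ≫ (Scheme.Etale.forget L.X).map g)).symm
    refine (Category.assoc _ _ _).trans ?_
    refine (congrArg (fun t => (F.liftPt x v).left ≫ t) (etalePullback_map_left_fst F.f g)).trans ?_
    refine (Category.assoc _ _ _).symm.trans ?_
    exact congrArg (fun t => t ≫ ((Scheme.Etale.forget L.X).map g).left) (F.liftPt_left_fst x v)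
  · refine Eq.trans ?_ (pullback.lift_snd _ _ _).symm
    refine (Category.assoc _ _ _).trans ?_
    refine (congrArg (fun t => (F.liftPt x v).left ≫ t) (etalePullback_map_left_snd F.f g)).trans ?_
    exact pullback.lift_snd _ _ _

/-- The homomorphism of stalks of log structures. -/
def stalkMap (x : Spec (CommRingCat.of ℂ) ⟶ K.X) : L.stalk (x ≫ F.f) →* K.stalk x :=
  ((L.geomPoint (x ≫ F.f)).presheafFiberDesc (P := L.M) (T := K.stalk x)
    (fun V v => F.φ.app (op V) ≫
      (K.geomPoint x).toPresheafFiber ((etalePullback F.f).obj V) (F.liftPt x v) K.M)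
    (fun V W g v => by
      refine (F.φ.naturality_assoc g.op _).trans ?_
      refine congrArg (fun t => F.φ.app (op W) ≫ t) ?_
      refine ((K.geomPoint x).toPresheafFiber_w ((etalePullback F.f).map g)
        (F.liftPt x v) K.M).trans ?_
      exact congrArg (fun t => (K.geomPoint x).toPresheafFiber _ t K.M) (F.liftPt_comp x g v))).hom

lemma stalkMap_germ (x : Spec (CommRingCat.of ℂ) ⟶ K.X) {V : L.X.Etale}
    (v : L.Lift (x ≫ F.f) V) (m : L.M.obj (op V)) :
    F.stalkMap x (L.germ (x ≫ F.f) v m) = K.germ x (F.liftPt x v) (F.φ.app (op V) m) :=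
  ConcreteCategory.congr_hom
    ((L.geomPoint (x ≫ F.f)).toPresheafFiber_presheafFiberDesc (P := L.M) (T := K.stalk x) _ _ V v) m

lemma φ_unitSec (V : L.X.Etale) (v : (etRing V)ˣ) :
    F.φ.app (op V) (L.unitSec V v) = K.unitSec ((etalePullback F.f).obj V)
      (Units.map (pullback.fst V.hom F.f).appTop.hom.toMonoidHom v) := by
  refine K.eq_unitSec _ _ _ ?_
  refine (ConcreteCategory.congr_hom (NatTrans.congr_app F.comm (op V)) (L.unitSec V v)).trans ?_
  exact congrArg (pullback.fst V.hom F.f).appTop.hom (L.α_unitSec V v)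

/-- The map on Kato–Nakayama spaces. -/
def mapKN (x : K.KNPoint) : L.KNPoint where
  pt := F.mapAn x.pt
  c := Algebra.GrothendieckGroup.lift
    ((x.c.comp Algebra.GrothendieckGroup.of).comp (F.stalkMap x.pt.hom))
  norm V v s := by
    refine Eq.trans ?_ ((x.norm _ (F.liftPt x.pt.hom v)
      (Units.map (pullback.fst V.hom F.f).appTop.hom.toMonoidHom s)).trans ?_)
    · refine congrArg (fun z : Circle => (z : ℂ)) ?_
      refine (DFunLike.congr_fun (Algebra.GrothendieckGroup.lift.symm_apply_apply _) _).trans ?_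
      refine congrArg (fun z => x.c (Algebra.GrothendieckGroup.of z)) ?_
      exact (F.stalkMap_germ x.pt.hom v _).trans (congrArg _ (F.φ_unitSec V s))
    · have h : evalAt (F.liftPt x.pt.hom v).left
          ((pullback.fst V.hom F.f).appTop.hom s.1) = evalAt v.left s.1 :=
        (evalAt_comp _ _ _).symm.trans
          (congrArg (fun t => evalAt t s.1) (F.liftPt_left_fst x.pt.hom v))
      exact congrArg (fun z : ℂ => z / ‖z‖) h

end LogHom

end

noncomputable section

variable {X X' : Scheme.{0}}

section AssocMap

variable {P P' : Type} [CommMonoid P] [CommMonoid P'] (g : X' ⟶ X)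
  (a : P →* Γ(X, ⊤)) (a' : P' →* Γ(X', ⊤)) (θ : P →* P') (u : P →* (Γ(X', ⊤))ˣ)
  (h : ∀ p, g.appTop.hom (a p) = a' (θ p) * u p)

lemma etChart_pullback (h : ∀ p, g.appTop.hom (a p) = a' (θ p) * u p) (V : X.Etale) (p : P) :
    (pullback.fst V.hom g).appTop.hom (etChart a V p) =
      etChart a' ((etalePullback g).obj V) (θ p) *
        (Units.map (etOfTop ((etalePullback g).obj V)).toMonoidHom (u p)).1 := by
  have e : (pullback.fst V.hom g).appTop.hom (V.hom.appTop.hom (a p)) =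
      (pullback.snd V.hom g).appTop.hom (g.appTop.hom (a p)) := by
    have e0 := congrArg (fun t => Scheme.Hom.appTop t) (pullback.condition (f := V.hom) (g := g))
    exact ConcreteCategory.congr_hom e0 (a p)
  refine e.trans ?_
  rw [h, map_mul]
  rfl

/-- The map on presheaf pushouts `(p, v) ↦ (θ p, u p * g^♯ v)`. -/
def assocPresheafMap : assocPresheaf a ⟶ (etalePullback g).op ⋙ assocPresheaf a' where
  app V := CommMonCat.ofHom (Assoc.map (etChart a V.unop)
    (etChart a' ((etalePullback g).obj V.unop)) θ
    (pullback.fst V.unop.hom g).appTop.hom.toMonoidHom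
    ((Units.map (etOfTop ((etalePullback g).obj V.unop)).toMonoidHom).comp u)
    (etChart_pullback g a a' θ u h V.unop))
  naturality V W k := by
    apply ConcreteCategory.hom_ext
    intro x
    obtain ⟨⟨p, v⟩, rfl⟩ := (assocCon (etChart a V.unop)).mk'_surjective x
    refine (congrArg (Assoc.map (etChart a W.unop) _ θ _ _
      (etChart_pullback g a a' θ u h W.unop)) (assocRes_mk a k.unop p v)).trans ?_
    refine (Assoc.map_mk _ _ _ _ _ _ _).trans ?_
    refine Eq.trans ?_ (congrArg (assocRes a' ((etalePullback g).map k.unop))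
      (Assoc.map_mk _ _ _ _ _ (etChart_pullback g a a' θ u h V.unop) (p, v))).symm
    refine Eq.trans ?_ (assocRes_mk a' _ _ _).symm
    refine congrArg (Assoc.mk _) (Prod.ext rfl (Units.ext ?_))
    refine Eq.trans ?_ (map_mul (etRes ((etalePullback g).map k.unop)) _ _).symm
    refine congrArg₂ (fun s t => s * t) (etRes_etOfTop ((etalePullback g).map k.unop) (u p).1).symm ?_
    exact ConcreteCategory.congr_hom ((etaleFunPullback g).naturality k) v.1

/-- The map on associated log structures `(p, v) ↦ (θ p, u p * g^♯ v)`. -/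
def assocLogMap : assocLog a ⟶ (etalePullback g).op ⋙ assocLog a' :=
  sheafifyLift X.smallEtaleTopology
    (assocPresheafMap g a a' θ u h ≫ Functor.whiskerLeft _ (toAssocLog a'))
    (Functor.op_comp_isSheaf (etalePullback g) X.smallEtaleTopology X'.smallEtaleTopology
      ⟨_, assocLog_isSheaf a'⟩)

lemma toAssocLog_assocLogMap : toAssocLog a ≫ assocLogMap g a a' θ u h =
    assocPresheafMap g a a' θ u h ≫ Functor.whiskerLeft _ (toAssocLog a') :=
  toSheafify_sheafifyLift _ _ _

lemma assocLogMap_comm : assocLogMap g a a' θ u h ≫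
    Functor.whiskerLeft (etalePullback g).op (assocLogToFun a') =
      assocLogToFun a ≫ etaleFunPullback g := by
  refine sheafify_hom_ext X.smallEtaleTopology _ _
    (Functor.op_comp_isSheaf (etalePullback g) X.smallEtaleTopology X'.smallEtaleTopology
      ⟨_, isSheaf_etaleFun X'⟩) ?_
  change toAssocLog a ≫ _ = toAssocLog a ≫ _
  rw [← Category.assoc, ← Category.assoc, toAssocLog_assocLogMap, toAssocLog_toFun, Category.assoc,
    ← Functor.whiskerLeft_comp, toAssocLog_toFun]
  ext V x
  obtain ⟨⟨p, v⟩, rfl⟩ := (assocCon (etChart a V.unop)).mk'_surjective x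
  exact Assoc.toRing_map (etChart a V.unop) (etChart a' ((etalePullback g).obj V.unop)) θ
    (pullback.fst V.unop.hom g).appTop.hom.toMonoidHom
    ((Units.map (etOfTop ((etalePullback g).obj V.unop)).toMonoidHom).comp u)
    (etChart_pullback g a a' θ u h V.unop) (Assoc.mk (etChart a V.unop) (p, v))

end AssocMap

/-- The terminal object of the small étale site. -/
def etTop (X : Scheme.{0}) : X.Etale := Scheme.Etale.mk (𝟙 X)

/-- The structure map to the terminal object of the small étale site. -/
def toEtTop (U : X.Etale) : U ⟶ etTop X :=
  (Scheme.Etale.forgetFullyFaithful X).preimage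
    (X := U) (Y := etTop X) (Over.homMk (V := Over.mk (𝟙 X)) ((Scheme.Etale.forget X).obj U).hom (Category.comp_id _))

lemma forget_map_toEtTop (U : X.Etale) : ((Scheme.Etale.forget X).map (toEtTop U)).left =
    ((Scheme.Etale.forget X).obj U).hom :=
  (congrArg (fun t => Over.Hom.left t) ((Scheme.Etale.forgetFullyFaithful X).map_preimage
    (X := U) (Y := etTop X) _)).trans rfl

lemma comp_toEtTop {U V : X.Etale} (k : U ⟶ V) : k ≫ toEtTop V = toEtTop U := by
  apply (Scheme.Etale.forget X).map_injective
  exact Over.mkIdTerminal.hom_ext _ _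

lemma etRes_toEtTop (U : X.Etale) (s : Γ(X, ⊤)) : etRes (toEtTop U) s = etOfTop U s :=
  congrArg (fun t : ((Scheme.Etale.forget X).obj U).left ⟶ X => t.appTop.hom s)
    (forget_map_toEtTop U)

namespace LogScheme

section Canonical

variable (L : LogScheme) {P : Type} [CommMonoid P] (a : P →* Γ(L.X, ⊤))
  (β : P →* L.M.obj (op (etTop L.X)))
  (h : ∀ p, L.α.app (op (etTop L.X)) (β p) = a p)

lemma res_unitSec {U V : L.X.Etale} (k : U ⟶ V) (v : (etRing V)ˣ) :
    L.M.map k.op (L.unitSec V v) = L.unitSec U (Units.map (etRes k).toMonoidHom v) := by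
  refine L.eq_unitSec _ _ _ ?_
  refine (NatTrans.naturality_apply L.α k.op _).trans ?_
  exact congrArg (etRes k) (L.α_unitSec V v)

lemma α_res (h : ∀ p, L.α.app (op (etTop L.X)) (β p) = a p) (U : L.X.Etale) (p : P) :
    L.α.app (op U) (L.M.map (toEtTop U).op (β p)) = etChart a U p := by
  refine (NatTrans.naturality_apply L.α (toEtTop U).op _).trans ?_
  refine (congrArg (etRes (toEtTop U)) (h p)).trans ?_
  exact etRes_toEtTop U (a p)

/-- The map `(p, v) ↦ β(p) · v` from the pushout to sections of `M`. -/
def canonicalApp (U : L.X.Etale) : Assoc (etChart a U) →* L.M.obj (op U) :=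
  (assocCon (etChart a U)).lift
    (((L.M.map (toEtTop U).op).hom.comp β).coprod (L.unitSec U)) (by
    refine Con.conGen_le.2 ?_
    rintro _ _ ⟨p, w, hw, rfl, rfl⟩
    change L.M.map (toEtTop U).op (β p) * L.unitSec U 1 =
      L.M.map (toEtTop U).op (β 1) * L.unitSec U w
    rw [map_one, map_one, mul_one, map_one, one_mul]
    exact L.eq_unitSec U w _ ((L.α_res a β h U p).trans hw))

lemma canonicalApp_mk (U : L.X.Etale) (p : P) (v : (etRing U)ˣ) :
    L.canonicalApp a β h U (Assoc.mk (etChart a U) (p, v)) =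
      L.M.map (toEtTop U).op (β p) * L.unitSec U v := rfl

/-- The canonical map from the presheaf pushout to `M`. -/
def canonicalPresheafMap : assocPresheaf a ⟶ L.M where
  app U := CommMonCat.ofHom (L.canonicalApp a β h U.unop)
  naturality V U k := by
    apply ConcreteCategory.hom_ext
    intro x
    obtain ⟨⟨p, v⟩, rfl⟩ := (assocCon (etChart a V.unop)).mk'_surjective x
    refine (congrArg (L.canonicalApp a β h U.unop) (assocRes_mk a k.unop p v)).trans ?_
    rw [canonicalApp_mk]
    refine Eq.trans ?_ (map_mul (L.M.map k).hom _ _).symm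
    refine congrArg₂ (fun s t => s * t) ?_ (L.res_unitSec k.unop v).symm
    refine Eq.trans ?_ (ConcreteCategory.congr_hom
      (L.M.map_comp (toEtTop V.unop).op k) (β p))
    exact congrArg (fun t => L.M.map (Quiver.Hom.op t) (β p)) (comp_toEtTop k.unop).symm

/-- The canonical map `P^a → M` from the log structure associated with `P`. -/
def canonicalMap : assocLog a ⟶ L.M :=
  sheafifyLift L.X.smallEtaleTopology (L.canonicalPresheafMap a β h) L.isSheaf

lemma toAssocLog_canonicalMap :
    toAssocLog a ≫ L.canonicalMap a β h = L.canonicalPresheafMap a β h :=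
  toSheafify_sheafifyLift _ _ _

lemma canonicalMap_α : L.canonicalMap a β h ≫ L.α = assocLogToFun a := by
  refine sheafify_hom_ext L.X.smallEtaleTopology _ _ (isSheaf_etaleFun L.X) ?_
  change toAssocLog a ≫ _ = toAssocLog a ≫ _
  rw [← Category.assoc, toAssocLog_canonicalMap, toAssocLog_toFun]
  ext U x
  obtain ⟨⟨p, v⟩, rfl⟩ := (assocCon (etChart a U.unop)).mk'_surjective x
  refine (map_mul (L.α.app U).hom _ _).trans ?_
  exact congrArg₂ (fun s t : etRing U.unop => s * t) (L.α_res a β h U.unop p)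
    (L.α_unitSec U.unop v)

end Canonical

/-- The log scheme over `ℂ` whose log structure is associated with `a : P → Γ(X, O_X)`. -/
abbrev ofChart (s : X ⟶ Spec (CommRingCat.of ℂ)) {P : Type} [CommMonoid P] (a : P →* Γ(X, ⊤)) :
    LogScheme where
  X := X
  str := s
  M := assocLog a
  isSheaf := assocLog_isSheaf a
  α := assocLogToFun a
  units := assocLog_units a

/-- The tautological chart `P → M` of `ofChart`. -/
def ofChartSec (s : X ⟶ Spec (CommRingCat.of ℂ)) {P : Type} [CommMonoid P] (a : P →* Γ(X, ⊤)) :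
    P →* (ofChart s a).M.obj (op (etTop X)) :=
  ((toAssocLog a).app (op (etTop X))).hom.comp
    ((Assoc.mk (etChart a (etTop X))).comp (MonoidHom.inl P _))

lemma α_toAssocLog (s : X ⟶ Spec (CommRingCat.of ℂ)) {P : Type} [CommMonoid P]
    (a : P →* Γ(X, ⊤)) (U : X.Etale) (p : P) (v : (etRing U)ˣ) :
    (ofChart s a).α.app (op U) ((toAssocLog a).app (op U) (Assoc.mk (etChart a U) (p, v))) =
      etChart a U p * v.1 :=
  ConcreteCategory.congr_hom (NatTrans.congr_app (toAssocLog_toFun a) (op U))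
    (Assoc.mk (etChart a U) (p, v))

lemma α_ofChartSec (s : X ⟶ Spec (CommRingCat.of ℂ)) {P : Type} [CommMonoid P]
    (a : P →* Γ(X, ⊤)) (p : P) :
    (ofChart s a).α.app (op (etTop X)) (ofChartSec s a p) = a p := by
  refine (α_toAssocLog s a (etTop X) p 1).trans ?_
  rw [Units.val_one, mul_one]
  change (𝟙 X : X ⟶ X).appTop.hom (a p) = a p
  rw [Scheme.Hom.id_appTop]
  rfl

lemma canonicalMap_ofChart (s : X ⟶ Spec (CommRingCat.of ℂ)) {P : Type} [CommMonoid P]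
    (a : P →* Γ(X, ⊤)) :
    (ofChart s a).canonicalMap a (ofChartSec s a) (α_ofChartSec s a) = 𝟙 _ := by
  refine sheafify_hom_ext X.smallEtaleTopology _ _ (assocLog_isSheaf a) ?_
  refine ((ofChart s a).toAssocLog_canonicalMap a (ofChartSec s a) (α_ofChartSec s a)).trans ?_
  refine Eq.trans ?_ (Category.comp_id (toAssocLog a)).symm
  ext U x
  obtain ⟨⟨p, v⟩, rfl⟩ := (assocCon (etChart a U.unop)).mk'_surjective x
  refine ((ofChart s a).canonicalApp_mk a _ (α_ofChartSec s a) U.unop p v).trans ?_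
  have e1 : (ofChart s a).M.map (toEtTop U.unop).op (ofChartSec s a p) =
      (toAssocLog a).app U (Assoc.mk (etChart a U.unop) (p, 1)) := by
    refine (NatTrans.naturality_apply (toAssocLog a) (toEtTop U.unop).op _).symm.trans ?_
    refine congrArg ((toAssocLog a).app U).hom ((assocRes_mk a _ p 1).trans ?_)
    rw [map_one]
  have e2 : (ofChart s a).unitSec U.unop v =
      (toAssocLog a).app U (Assoc.mk (etChart a U.unop) (1, v)) := by
    refine ((ofChart s a).eq_unitSec U.unop v _ ((α_toAssocLog s a U.unop 1 v).trans ?_)).symm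
    rw [map_one, one_mul]
  refine (congrArg₂ (fun s t => s * t) e1 e2).trans ?_
  refine (map_mul ((toAssocLog a).app U).hom _ _).symm.trans ?_
  refine congrArg ((toAssocLog a).app U).hom ?_
  refine (map_mul (Assoc.mk (etChart a U.unop)) _ _).symm.trans ?_
  rw [Prod.mk_mul_mk, mul_one, one_mul]

end LogScheme

end

noncomputable section

section Charts

variable {X : Scheme.{0}} {P : Type} [AddCommMonoid P]

/-- The scheme `Spec ℂ[P]`. -/
abbrev specMonoid (P : Type) [AddCommMonoid P] : Scheme.{0} :=
  Spec (CommRingCat.of (AddMonoidAlgebra ℂ P))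

/-- The structure morphism of `Spec ℂ[P]`. -/
abbrev specMonoidStr (P : Type) [AddCommMonoid P] :
    specMonoid P ⟶ Spec (CommRingCat.of ℂ) :=
  Spec.map (CommRingCat.ofHom (algebraMap ℂ (AddMonoidAlgebra ℂ P)))

/-- The pullback of regular functions from `Spec R`. -/
def specPullback {R : Type} [CommRing R] (f : X ⟶ Spec (CommRingCat.of R)) : R →+* Γ(X, ⊤) :=
  f.appTop.hom.comp (Scheme.ΓSpecIso (CommRingCat.of R)).inv.hom

lemma specPullback_comp {X' : Scheme.{0}} {R : Type} [CommRing R] (g : X' ⟶ X)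
    (f : X ⟶ Spec (CommRingCat.of R)) (r : R) :
    specPullback (g ≫ f) r = g.appTop.hom (specPullback f r) := by
  change (g ≫ f).appTop.hom _ = _
  rw [Scheme.Hom.comp_appTop]
  rfl

lemma specPullback_map {R S : Type} [CommRing R] [CommRing S] (k : R →+* S)
    (f : X ⟶ Spec (CommRingCat.of S)) (r : R) :
    specPullback (f ≫ Spec.map (CommRingCat.ofHom k)) r = specPullback f (k r) := by
  rw [specPullback_comp]
  refine congrArg f.appTop.hom ?_
  exact (ConcreteCategory.congr_hom (Scheme.ΓSpecIso_inv_naturality (CommRingCat.ofHom k)) r).symm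

/-- The homomorphism `P → Γ(X, O_X)` corresponding to `X ⟶ Spec ℂ[P]`. -/
def chartFun (f : X ⟶ specMonoid P) : Multiplicative P →* Γ(X, ⊤) :=
  (specPullback f).toMonoidHom.comp (AddMonoidAlgebra.of ℂ P)

end Charts

/-- A Kato chart `X ⟶ Spec ℂ[P]` of a log scheme `X` over `ℂ`: a morphism `f` over `ℂ` and a lift
`β : P → M(X)` of the induced map `P → Γ(X, O_X)` identifying `M` with the log structure associated
with `P → Γ(X, O_X)`, that is, with the pullback of the canonical log structure of `Spec ℂ[P]`. -/
structure KatoChart (L : LogScheme) (P : Type) [AddCommMonoid P] where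
  f : L.X ⟶ specMonoid P
  w : f ≫ specMonoidStr P = L.str
  β : Multiplicative P →* L.M.obj (op (etTop L.X))
  compat : ∀ p, L.α.app (op (etTop L.X)) (β p) = chartFun f p
  strict : IsIso (L.canonicalMap (chartFun f) β compat)

/-- The monoid `(1/n)P`: a copy of `P`, whose element `p` is thought of as `p/n`. -/
def RootMonoid (_n : ℕ) (P : Type) : Type := P

instance (n : ℕ) (P : Type) [h : AddCommMonoid P] : AddCommMonoid (RootMonoid n P) := h

/-- The map `P → (1/n)P`, `p ↦ (n p)/n`. -/
def RootMonoid.incl (n : ℕ) (P : Type) [AddCommMonoid P] : P →+ RootMonoid n P :=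
  nsmulAddMonoidHom (α := P) n

/-- The cokernel of `P^gp → (1/n)P^gp`. -/
abbrev RootCoker (n : ℕ) (P : Type) [AddCommMonoid P] : Type :=
  Algebra.GrothendieckAddGroup (RootMonoid n P) ⧸
    (Algebra.GrothendieckAddGroup.lift
      ((Algebra.GrothendieckAddGroup.of (M := RootMonoid n P)).comp (RootMonoid.incl n P))).range

/-- The class of an element of `(1/n)P` in the cokernel. -/
def RootCoker.cls (n : ℕ) (P : Type) [AddCommMonoid P] : RootMonoid n P →+ RootCoker n P :=
  (QuotientAddGroup.mk' _).comp Algebra.GrothendieckAddGroup.of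

lemma RootCoker.cls_incl (n : ℕ) (P : Type) [AddCommMonoid P] (p : P) :
    RootCoker.cls n P (RootMonoid.incl n P p) = 0 :=
  (QuotientAddGroup.eq_zero_iff _).2 ⟨Algebra.GrothendieckAddGroup.of p,
    DFunLike.congr_fun (Algebra.GrothendieckAddGroup.lift.symm_apply_apply
      ((Algebra.GrothendieckAddGroup.of (M := RootMonoid n P)).comp (RootMonoid.incl n P))) p⟩

/-- The group `μ_n(P)_an = Hom(coker (P^gp → (1/n)P^gp), ℂˣ)` of `ℂ`-points of the Cartier dual of
the cokernel. -/
def RootMu (n : ℕ) (P : Type) [AddCommMonoid P] : Type :=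
  Multiplicative (RootCoker n P) →* ℂˣ

instance (n : ℕ) (P : Type) [AddCommMonoid P] : CommGroup (RootMu n P) :=
  inferInstanceAs (CommGroup (Multiplicative (RootCoker n P) →* ℂˣ))

/-- A point of `μ_n(P)_an` as a character. -/
def RootMu.toHom {n : ℕ} {P : Type} [AddCommMonoid P] (χ : RootMu n P) :
    Multiplicative (RootCoker n P) →* ℂˣ := χ

/-- The topology of pointwise convergence. -/
instance (n : ℕ) (P : Type) [AddCommMonoid P] : TopologicalSpace (RootMu n P) :=
  TopologicalSpace.induced
    (fun (χ : RootMu n P) (z : Multiplicative (RootCoker n P)) => χ.toHom z)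
    inferInstance

/-- The restriction of a character to `(1/n)P`. -/
def RootMu.char {n : ℕ} {P : Type} [AddCommMonoid P] (χ : RootMu n P) :
    Multiplicative (RootMonoid n P) →* ℂˣ :=
  χ.toHom.comp (RootCoker.cls n P).toMultiplicative

lemma RootMu.char_incl {n : ℕ} {P : Type} [AddCommMonoid P] (χ : RootMu n P) (p : P) :
    χ.char (Multiplicative.ofAdd (RootMonoid.incl n P p)) = 1 := by
  change χ.toHom
    (Multiplicative.ofAdd (RootCoker.cls n P (RootMonoid.incl n P p))) = 1
  rw [RootCoker.cls_incl]
  exact map_one χ.toHom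

/-- The automorphism `q ↦ χ(q) q` of `ℂ[(1/n)P]`. -/
def RootMu.twist {n : ℕ} {P : Type} [AddCommMonoid P] (χ : RootMu n P) :
    AddMonoidAlgebra ℂ (RootMonoid n P) →ₐ[ℂ] AddMonoidAlgebra ℂ (RootMonoid n P) :=
  AddMonoidAlgebra.lift ℂ (AddMonoidAlgebra ℂ (RootMonoid n P)) (RootMonoid n P)
    ((((algebraMap ℂ (AddMonoidAlgebra ℂ (RootMonoid n P))).toMonoidHom.comp
      (Units.coeHom ℂ)).comp χ.char) * AddMonoidAlgebra.of ℂ (RootMonoid n P))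

lemma RootMu.twist_of {n : ℕ} {P : Type} [AddCommMonoid P] (χ : RootMu n P)
    (q : Multiplicative (RootMonoid n P)) :
    χ.twist (AddMonoidAlgebra.of ℂ (RootMonoid n P) q) =
      algebraMap ℂ _ (χ.char q : ℂ) * AddMonoidAlgebra.of ℂ (RootMonoid n P) q :=
  AddMonoidAlgebra.lift_of _ _

/-- The homomorphism `ℂ[P] → ℂ[(1/n)P]`. -/
def rootAlg (n : ℕ) (P : Type) [AddCommMonoid P] :
    AddMonoidAlgebra ℂ P →ₐ[ℂ] AddMonoidAlgebra ℂ (RootMonoid n P) :=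
  AddMonoidAlgebra.lift ℂ (AddMonoidAlgebra ℂ (RootMonoid n P)) P
    ((AddMonoidAlgebra.of ℂ (RootMonoid n P)).comp (RootMonoid.incl n P).toMultiplicative)

lemma rootAlg_of (n : ℕ) (P : Type) [AddCommMonoid P] (p : Multiplicative P) :
    rootAlg n P (AddMonoidAlgebra.of ℂ P p) = AddMonoidAlgebra.of ℂ (RootMonoid n P)
      (Multiplicative.ofAdd (RootMonoid.incl n P p.toAdd)) :=
  AddMonoidAlgebra.lift_of _ _

lemma twist_rootAlg {n : ℕ} {P : Type} [AddCommMonoid P] (χ : RootMu n P) :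
    χ.twist.comp (rootAlg n P) = rootAlg n P := by
  apply (AddMonoidAlgebra.lift ℂ (AddMonoidAlgebra ℂ (RootMonoid n P)) P).symm.injective
  refine MonoidHom.ext fun p => ?_
  change χ.twist (rootAlg n P (AddMonoidAlgebra.of ℂ P p)) = rootAlg n P (AddMonoidAlgebra.of ℂ P p)
  rw [rootAlg_of, RootMu.twist_of]
  refine Eq.trans (congrArg (fun c : ℂˣ => algebraMap ℂ (AddMonoidAlgebra ℂ (RootMonoid n P)) c *
    AddMonoidAlgebra.of ℂ (RootMonoid n P)
      (Multiplicative.ofAdd (RootMonoid.incl n P (Multiplicative.toAdd p)))) (χ.char_incl p.toAdd)) ?_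
  rw [Units.val_one, map_one, one_mul]

/-- The morphism `Spec ℂ[(1/n)P] ⟶ Spec ℂ[P]`. -/
def rootSpec (n : ℕ) (P : Type) [AddCommMonoid P] : specMonoid (RootMonoid n P) ⟶ specMonoid P :=
  Spec.map (CommRingCat.ofHom (rootAlg n P).toRingHom)

lemma rootSpec_str (n : ℕ) (P : Type) [AddCommMonoid P] :
    rootSpec n P ≫ specMonoidStr P = specMonoidStr (RootMonoid n P) := by
  rw [rootSpec, specMonoidStr, ← Spec.map_comp, ← CommRingCat.ofHom_comp]
  congr 2
  exact (rootAlg n P).comp_algebraMap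

/-- The action of a character on `Spec ℂ[(1/n)P]`. -/
def RootMu.specTwist {n : ℕ} {P : Type} [AddCommMonoid P] (χ : RootMu n P) :
    specMonoid (RootMonoid n P) ⟶ specMonoid (RootMonoid n P) :=
  Spec.map (CommRingCat.ofHom χ.twist.toRingHom)

lemma RootMu.specTwist_rootSpec {n : ℕ} {P : Type} [AddCommMonoid P] (χ : RootMu n P) :
    χ.specTwist ≫ rootSpec n P = rootSpec n P := by
  rw [rootSpec, specTwist, ← Spec.map_comp, ← CommRingCat.ofHom_comp]
  congr 2
  exact congrArg AlgHom.toRingHom (twist_rootAlg χ)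

lemma RootMu.specTwist_str {n : ℕ} {P : Type} [AddCommMonoid P] (χ : RootMu n P) :
    χ.specTwist ≫ specMonoidStr (RootMonoid n P) = specMonoidStr (RootMonoid n P) := by
  rw [specTwist, specMonoidStr, ← Spec.map_comp, ← CommRingCat.ofHom_comp]
  congr 2
  exact χ.twist.comp_algebraMap

namespace KatoChart

variable {L : LogScheme} {P : Type} [AddCommMonoid P] (C : KatoChart L P)

/-- The evaluation of the chart at a point of the Kato–Nakayama space: the homomorphism
`P → ℝ_{≥0} × S¹`, `p ↦ (|p(x)|, c(p))`, that is, a point of `ℂ(P)_log`. -/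
def polar (x : L.KNPoint) (p : P) : NNReal × Circle :=
  (‖evalAt x.pt.hom (chartFun C.f (Multiplicative.ofAdd p))‖₊,
    x.c (Algebra.GrothendieckGroup.of (L.germ x.pt.hom (U := etTop L.X)
      (Over.homMk (V := Over.mk (𝟙 L.X)) x.pt.hom (Category.comp_id _))
      (C.β (Multiplicative.ofAdd p)))))

/-- The Kato–Nakayama space `X_log`. -/
def Log (_C : KatoChart L P) : Type := L.KNPoint

/-- The topology of `X_log = X_an ×_{ℂ(P)} ℂ(P)_log`, where `ℂ(P)_log = Hom(P, ℝ_{≥0} × S¹)` carries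
the topology of pointwise convergence. -/
instance : TopologicalSpace C.Log :=
  TopologicalSpace.induced (fun x : L.KNPoint => (x.pt, C.polar x)) inferInstance

/-- The projection `X_log → X_an`. -/
def toAn (x : C.Log) : L.An := LogScheme.KNPoint.pt x

variable (n : ℕ)

/-- The scheme underlying `X_n = X ×_{Spec ℂ[P]} Spec ℂ[(1/n)P]`. -/
abbrev rootScheme : Scheme.{0} := pullback C.f (rootSpec n P)

/-- The projection `X_n ⟶ Spec ℂ[(1/n)P]`. -/
abbrev rootProj : C.rootScheme n ⟶ specMonoid (RootMonoid n P) := pullback.snd C.f (rootSpec n P)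

/-- The log scheme `X_n`, with the log structure pulled back from `Spec ℂ[(1/n)P]`. -/
abbrev root : LogScheme :=
  LogScheme.ofChart (C.rootProj n ≫ specMonoidStr (RootMonoid n P)) (chartFun (C.rootProj n))

/-- The chart `X_n ⟶ Spec ℂ[(1/n)P]`. -/
def rootChart : KatoChart (C.root n) (RootMonoid n P) where
  f := C.rootProj n
  w := rfl
  β := LogScheme.ofChartSec (C.rootProj n ≫ specMonoidStr (RootMonoid n P))
    (chartFun (C.rootProj n))
  compat := LogScheme.α_ofChartSec _ _
  strict := by
    rw [LogScheme.canonicalMap_ofChart]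
    infer_instance

lemma rootMap_fun (p : Multiplicative P) :
    (pullback.fst C.f (rootSpec n P)).appTop.hom (chartFun C.f p) =
      chartFun (C.rootProj n) ((RootMonoid.incl n P).toMultiplicative p) *
        ((1 : Multiplicative P →* (Γ(C.rootScheme n, ⊤))ˣ) p) := by
  rw [MonoidHom.one_apply, Units.val_one, mul_one]
  refine (specPullback_comp _ C.f _).symm.trans ?_
  rw [pullback.condition]
  refine (specPullback_map _ _ _).trans ?_
  exact congrArg (specPullback (C.rootProj n)) (rootAlg_of n P p)

lemma rootMap_str : pullback.fst C.f (rootSpec n P) ≫ L.str =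
    C.rootProj n ≫ specMonoidStr (RootMonoid n P) := by
  rw [← C.w, ← rootSpec_str, ← Category.assoc, ← Category.assoc, pullback.condition]

/-- The map of log structures `M_X → φ_* M_{X_n}`, `p ↦ (n p)/n`. -/
def rootMapLogStr : L.M ⟶ (etalePullback (pullback.fst C.f (rootSpec n P))).op ⋙
    assocLog (chartFun (C.rootProj n)) :=
  haveI := C.strict
  inv (L.canonicalMap (chartFun C.f) C.β C.compat) ≫
    assocLogMap (pullback.fst C.f (rootSpec n P)) (chartFun C.f) (chartFun (C.rootProj n))
      (RootMonoid.incl n P).toMultiplicative 1 (C.rootMap_fun n)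

lemma rootMapLogStr_comm : C.rootMapLogStr n ≫
    Functor.whiskerLeft (etalePullback (pullback.fst C.f (rootSpec n P))).op
      (assocLogToFun (chartFun (C.rootProj n))) =
        L.α ≫ etaleFunPullback (pullback.fst C.f (rootSpec n P)) := by
  have := C.strict
  rw [rootMapLogStr, Category.assoc, IsIso.inv_comp_eq, ← Category.assoc, LogScheme.canonicalMap_α]
  exact assocLogMap_comm _ _ _ _ _ _

/-- The morphism of log schemes `φ : X_n ⟶ X`; on log structures it is `p ↦ (n p)/n`. -/
def rootMap : LogHom (C.root n) L where
  f := pullback.fst C.f (rootSpec n P)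
  w := C.rootMap_str n
  φ := C.rootMapLogStr n
  comm := C.rootMapLogStr_comm n

/-- The action of a character on the scheme `X_n`. -/
def actScheme {n : ℕ} (χ : RootMu n P) : C.rootScheme n ⟶ C.rootScheme n :=
  pullback.lift (pullback.fst C.f (rootSpec n P)) (C.rootProj n ≫ χ.specTwist) (by
    rw [Category.assoc, χ.specTwist_rootSpec, pullback.condition])

/-- The values of a character as constant invertible functions. -/
def charFun {n : ℕ} (χ : RootMu n P) :
    Multiplicative (RootMonoid n P) →* (Γ(C.rootScheme n, ⊤))ˣ :=
  (Units.map (specPullback (C.root n).str).toMonoidHom).comp χ.char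

lemma actScheme_fun {n : ℕ} (χ : RootMu n P) (q : Multiplicative (RootMonoid n P)) :
    (C.actScheme χ).appTop.hom (chartFun (C.rootProj n) q) =
      chartFun (C.rootProj n) (MonoidHom.id _ q) * C.charFun χ q := by
  refine (specPullback_comp _ _ _).symm.trans ?_
  rw [actScheme, pullback.lift_snd]
  refine (specPullback_map _ _ _).trans ?_
  refine (congrArg (specPullback (C.rootProj n)) (χ.twist_of q)).trans ?_
  rw [map_mul, mul_comm]
  refine congrArg (fun t => specPullback (C.rootProj n)
    (AddMonoidAlgebra.of ℂ (RootMonoid n P) q) * t) ?_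
  exact (specPullback_map _ _ _).symm

lemma actScheme_str {n : ℕ} (χ : RootMu n P) :
    C.actScheme χ ≫ C.rootProj n ≫ specMonoidStr (RootMonoid n P) =
      C.rootProj n ≫ specMonoidStr (RootMonoid n P) := by
  rw [actScheme, pullback.lift_snd_assoc, Category.assoc, χ.specTwist_str]

/-- The action of a character `χ` on the log scheme `X_n`; on log structures it is
`q ↦ χ(q) · q`. -/
def act {n : ℕ} (χ : RootMu n P) : LogHom (C.root n) (C.root n) where
  f := C.actScheme χ
  w := C.actScheme_str χ
  φ := assocLogMap (C.actScheme χ) (chartFun (C.rootProj n)) (chartFun (C.rootProj n))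
    (MonoidHom.id _) (C.charFun χ) (C.actScheme_fun χ)
  comm := assocLogMap_comm _ _ _ _ _ _

/-- The map `φ_log : (X_n)_log → X_log`. -/
def rootMapLog : (C.rootChart n).Log → C.Log := (C.rootMap n).mapKN

/-- The action of `μ_n(P)_an` on `(X_n)_an`. -/
def actAn {n : ℕ} (χ : RootMu n P) : (C.root n).An → (C.root n).An := (C.act χ).mapAn

/-- The action of `μ_n(P)_an` on `(X_n)_log`. -/
def actLog {n : ℕ} (χ : RootMu n P) : (C.rootChart n).Log → (C.rootChart n).Log := (C.act χ).mapKN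

end KatoChart

end

section Bundles

/-- `π : E → B` is a principal `G`-bundle for the action `act` of the topological group `G`: a
continuous, fibrewise action for which `π` is locally the projection `V × G → V`, with `G` acting on
`V × G` by translations. -/
structure IsPrincipalBundle {G E B : Type} [Group G] [TopologicalSpace G] [TopologicalSpace E]
    [TopologicalSpace B] (act : G → E → E) (π : E → B) : Prop where
  one_act : ∀ e, act 1 e = e
  mul_act : ∀ g h e, act (g * h) e = act g (act h e)
  continuous_act : Continuous fun p : G × E => act p.1 p.2
  continuous_proj : Continuous π
  proj_act : ∀ g e, π (act g e) = π e
  locally_trivial : ∀ b : B, ∃ V : Set B, IsOpen V ∧ b ∈ V ∧ ∃ t : (V × G) ≃ₜ (π ⁻¹' V),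
    (∀ (v : V) (g : G), π (t (v, g)) = v) ∧
      ∀ (v : V) (g h : G), (t (v, h * g) : E) = act h (t (v, g))

variable {G Y : Type} [Group G] [TopologicalSpace G] [TopologicalSpace Y] (actY : G → Y → Y)

/-- An object of the quotient stack `[Y/G]` over a space `base`: a principal `G`-bundle over `base`
together with a `G`-equivariant continuous map from its total space to `Y`. -/
structure QuotientObj where
  base : TopCat.{0}
  total : TopCat.{0}
  act : G → total → total
  proj : total → base
  bundle : IsPrincipalBundle act proj
  toY : total → Y
  continuous_toY : Continuous toY
  toY_act : ∀ g e, toY (act g e) = actY g (toY e)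

variable {actY}

/-- A morphism in `[Y/G]`: a map of bundles over a map of bases, compatible with the maps to `Y`. -/
@[ext]
structure QuotientHom (A B : QuotientObj actY) where
  base : A.base ⟶ B.base
  total : A.total ⟶ B.total
  total_act : ∀ g e, total (A.act g e) = B.act g (total e)
  proj_total : ∀ e, B.proj (total e) = base (A.proj e)
  toY_total : ∀ e, B.toY (total e) = A.toY e

instance : Category (QuotientObj actY) where
  Hom := QuotientHom
  id A := ⟨𝟙 _, 𝟙 _, fun _ _ => rfl, fun _ => rfl, fun _ => rfl⟩
  comp f g := ⟨f.base ≫ g.base, f.total ≫ g.total,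
    fun a e => (congrArg g.total (f.total_act a e)).trans (g.total_act a _),
    fun e => (g.proj_total _).trans (congrArg g.base (f.proj_total e)),
    fun e => (g.toY_total _).trans (f.toY_total e)⟩

variable (actY)

/-- The quotient stack `[Y/G]`, as a category fibred in groupoids over topological spaces. -/
def quotientStack : BasedCategory TopCat.{0} where
  obj := QuotientObj actY
  p :=
    { obj := fun A => A.base
      map := fun f => QuotientHom.base f }

/-- The stack represented by a topological space `B`: its objects over `T` are the continuous maps
`T → B`. -/
def spaceStack (B : TopCat.{0}) : BasedCategory TopCat.{0} where
  obj := Over B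
  p := Over.forget B

end Bundles

noncomputable section

namespace KatoChart

variable {L : LogScheme} {P : Type} [AddCommMonoid P] (C : KatoChart L P) (n : ℕ)

/-- The topological `n`-th root stack of `X` in terms of the chart: `[(X_n)_an / μ_n(P)_an]`. -/
def rootStackTop : BasedCategory TopCat.{0} := quotientStack (C.actAn (n := n))

end KatoChart

end

end LogKN

namespace LogKN

noncomputable section

/-- The argument `z ↦ z / |z|` of nonzero complex numbers. -/
def unitPhase : ℂˣ →* Circle where
  toFun z := ⟨(z : ℂ) / ‖(z : ℂ)‖, by
    have : ‖(z : ℂ)‖ ≠ 0 := norm_ne_zero_iff.2 z.ne_zero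
    simp [Submonoid.unitSphere, this]⟩
  map_one' := by ext; simp
  map_mul' z w := by
    ext
    simp only [Units.val_mul, norm_mul, Complex.ofReal_mul, mul_div_mul_comm]
    rfl

lemma coe_unitPhase (z : ℂˣ) : (unitPhase z : ℂ) = (z : ℂ) / ‖(z : ℂ)‖ := rfl

namespace LogScheme

variable (L : LogScheme)

/-- The lift of a `ℂ`-point to the terminal étale scheme. -/
def topLift (x : Spec (CommRingCat.of ℂ) ⟶ L.X) : L.Lift x (etTop L.X) :=
  Over.homMk (V := Over.mk (𝟙 L.X)) x (Category.comp_id _)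

lemma germ_res {x : Spec (CommRingCat.of ℂ) ⟶ L.X} {U V : L.X.Etale} (k : U ⟶ V)
    (u : L.Lift x U) (m : L.M.obj (op V)) :
    L.germ x u (L.M.map k.op m) = L.germ x (u ≫ (Scheme.Etale.forget L.X).map k) m :=
  ConcreteCategory.congr_hom ((L.geomPoint x).toPresheafFiber_w k u L.M) m

lemma germ_toEtTop {x : Spec (CommRingCat.of ℂ) ⟶ L.X} {U : L.X.Etale} (u : L.Lift x U)
    (m : L.M.obj (op (etTop L.X))) :
    L.germ x u (L.M.map (toEtTop U).op m) = L.germ x (L.topLift x) m := by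
  rw [germ_res]
  exact congrArg (fun t => L.germ x t m) (Over.mkIdTerminal.hom_ext _ _)

lemma evalAt_etOfTop {x : Spec (CommRingCat.of ℂ) ⟶ L.X} {U : L.X.Etale} (u : L.Lift x U)
    (s : Γ(L.X, ⊤)) : evalAt u.left (etOfTop U s) = evalAt x s := by
  refine (evalAt_comp _ _ _).symm.trans (congrArg (fun t => evalAt t s) ?_)
  exact Over.w u

end LogScheme

namespace KatoChart

variable {L : LogScheme} {P : Type} [AddCommMonoid P] (C : KatoChart L P)

/-- The chart with values in the stalk at a `ℂ`-point. -/
def stalkChart (x : Spec (CommRingCat.of ℂ) ⟶ L.X) : Multiplicative P →* L.stalk x :=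
  (L.germ x (L.topLift x)).comp C.β

/-- The values of the chart at a `ℂ`-point. -/
def value (x : L.An) : Multiplicative P →* ℂ :=
  (evalAt x.hom).toMonoidHom.comp (chartFun C.f)

/-- The arguments of the chart at a point of the Kato–Nakayama space. -/
def phase (x : L.KNPoint) : Multiplicative P →* Circle :=
  (x.c.comp Algebra.GrothendieckGroup.of).comp (C.stalkChart x.pt.hom)

/-- The map from the stalk of the presheaf pushout to the stalk of `M`. -/
def stalkIso (x : Spec (CommRingCat.of ℂ) ⟶ L.X) :
    (L.geomPoint x).presheafFiber.obj (assocPresheaf (chartFun C.f)) ⟶ L.stalk x :=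
  (L.geomPoint x).presheafFiber.map (L.canonicalPresheafMap (chartFun C.f) C.β C.compat)

instance (x : Spec (CommRingCat.of ℂ) ⟶ L.X) : IsIso (C.stalkIso x) := by
  have h1 : IsIso ((L.geomPoint x).presheafFiber.map (toAssocLog (chartFun C.f))) :=
    inferInstanceAs (IsIso ((L.geomPoint x).presheafFiber.map (toSheafify _ _)))
  have h2 := C.strict
  rw [stalkIso, ← L.toAssocLog_canonicalMap, Functor.map_comp]
  exact IsIso.comp_isIso' h1 (Functor.map_isIso _ _)

lemma stalkIso_mk {x : Spec (CommRingCat.of ℂ) ⟶ L.X} {U : L.X.Etale} (u : L.Lift x U)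
    (p : Multiplicative P) (v : (etRing U)ˣ) :
    C.stalkIso x ((L.geomPoint x).toPresheafFiber U u (assocPresheaf (chartFun C.f))
      (Assoc.mk (etChart (chartFun C.f) U) (p, v))) =
      C.stalkChart x p * L.germ x u (L.unitSec U v) := by
  refine (ConcreteCategory.congr_hom ((L.geomPoint x).toPresheafFiber_naturality
    (L.canonicalPresheafMap (chartFun C.f) C.β C.compat) U u)
    (Assoc.mk (etChart (chartFun C.f) U) (p, v))).trans ?_
  refine Eq.trans ?_ (congrArg (· * L.germ x u (L.unitSec U v)) (L.germ_toEtTop u (C.β p)))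
  exact map_mul (L.germ x u) _ _

lemma exists_stalk_eq {x : Spec (CommRingCat.of ℂ) ⟶ L.X} (z : L.stalk x) :
    ∃ (U : L.X.Etale) (u : L.Lift x U) (p : Multiplicative P) (v : (etRing U)ˣ),
      z = C.stalkChart x p * L.germ x u (L.unitSec U v) := by
  obtain ⟨t, rfl⟩ : ∃ t, C.stalkIso x t = z :=
    ⟨inv (C.stalkIso x) z, ConcreteCategory.congr_hom (IsIso.inv_hom_id (C.stalkIso x)) z⟩
  obtain ⟨U, u, a, rfl⟩ := (L.geomPoint x).toPresheafFiber_jointly_surjective t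
  obtain ⟨⟨p, v⟩, rfl⟩ := (assocCon (etChart (chartFun C.f) U)).mk'_surjective a
  exact ⟨U, u, p, v, C.stalkIso_mk u p v⟩

lemma norm_eq_unitPhase (x : L.KNPoint) {U : L.X.Etale} (u : L.Lift x.pt.hom U)
    (v : (etRing U)ˣ) :
    x.c (Algebra.GrothendieckGroup.of (L.germ x.pt.hom u (L.unitSec U v))) =
      unitPhase (Units.map (evalAt u.left).toMonoidHom v) :=
  Circle.ext (x.norm U u v)

lemma log_ext {x y : L.KNPoint} (h : x.pt = y.pt) (hc : ∀ p, C.phase x p = C.phase y p) :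
    x = y := by
  obtain ⟨pt, c, hn⟩ := x
  obtain ⟨pt', c', hn'⟩ := y
  obtain rfl : pt = pt' := h
  obtain rfl : c = c' := by
    apply Algebra.GrothendieckGroup.lift.symm.injective
    refine MonoidHom.ext fun z => ?_
    obtain ⟨U, u, p, v, rfl⟩ := C.exists_stalk_eq z
    rw [map_mul, map_mul]
    refine congrArg₂ (· * ·) (hc p) ?_
    exact (norm_eq_unitPhase ⟨pt, c, hn⟩ u v).trans (norm_eq_unitPhase ⟨pt, c', hn'⟩ u v).symm
  rfl

lemma phase_of_value_ne_zero (x : L.KNPoint) (p : Multiplicative P) (h : C.value x.pt p ≠ 0) :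
    C.phase x p = unitPhase (Units.mk0 _ h) := by
  let s := chartFun C.f p
  let W : L.X.Opens := L.X.basicOpen s
  let U : L.X.Etale := Scheme.Etale.mk W.ι
  have hs : IsUnit (etChart (chartFun C.f) U p) := by
    have h1 := L.X.toRingedSpace.isUnit_res_basicOpen s
    have h2 : W.ι ''ᵁ ⊤ ≤ W := by rw [Scheme.Opens.ι_image_top]
    refine (congrArg IsUnit ?_).mp (h1.map (L.X.presheaf.map (homOfLE h2).op).hom)
    exact (ConcreteCategory.congr_hom (L.X.presheaf.map_comp (homOfLE (L.X.basicOpen_le s)).op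
      (homOfLE h2).op) s).symm
  have hx : Set.range x.pt.hom ⊆ Set.range W.ι := by
    rw [Scheme.Opens.range_ι]
    have h1 : IsUnit (x.pt.hom.appTop s) :=
      (isUnit_map_iff (Scheme.ΓSpecIso (CommRingCat.of ℂ)).commRingCatIsoToRingEquiv _).1
        (isUnit_iff_ne_zero.2 h)
    have h2 : x.pt.hom ⁻¹ᵁ W = ⊤ :=
      (Scheme.preimage_basicOpen_top x.pt.hom s).trans (Scheme.basicOpen_of_isUnit _ h1)
    rintro _ ⟨z, rfl⟩
    exact (h2.symm ▸ trivial : z ∈ x.pt.hom ⁻¹ᵁ W)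
  obtain ⟨v, hv⟩ := hs
  let u : L.Lift x.pt.hom U := Over.homMk (V := Over.mk W.ι) (IsOpenImmersion.lift W.ι x.pt.hom hx)
    (IsOpenImmersion.lift_fac _ _ _)
  have e : C.stalkChart x.pt.hom p = L.germ x.pt.hom u (L.unitSec U v) := by
    refine (L.germ_toEtTop u (C.β p)).symm.trans (congrArg _ ?_)
    exact L.eq_unitSec U v _ ((L.α_res _ C.β C.compat U p).trans hv.symm)
  refine (congrArg (fun t => x.c (Algebra.GrothendieckGroup.of t)) e).trans ?_
  refine (norm_eq_unitPhase x u v).trans (congrArg unitPhase (Units.ext ?_))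
  refine (congrArg (evalAt u.left) hv).trans ?_
  exact L.evalAt_etOfTop u s

lemma value_eq_norm_mul_phase (x : L.KNPoint) (p : Multiplicative P) :
    C.value x.pt p = ‖C.value x.pt p‖ * (C.phase x p : ℂ) := by
  by_cases h : C.value x.pt p = 0
  · rw [h, norm_zero, Complex.ofReal_zero, zero_mul]
  · have : (‖C.value x.pt p‖ : ℂ) ≠ 0 := by simpa using h
    rw [C.phase_of_value_ne_zero x p h, coe_unitPhase, Units.val_mk0, mul_div_cancel₀ _ this]

section Construct

variable (x : L.An) (c : Multiplicative P →* Circle)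
  (hc : ∀ p, C.value x p = ‖C.value x p‖ * (c p : ℂ))

/-- The homomorphism `(p, v) ↦ c(p) v(x)/|v(x)|` on sections of the presheaf pushout. -/
def phaseApp (hc : ∀ p, C.value x p = ‖C.value x p‖ * (c p : ℂ)) {U : L.X.Etale}
    (u : L.Lift x.hom U) : Assoc (etChart (chartFun C.f) U) →* Circle :=
  (assocCon (etChart (chartFun C.f) U)).lift
    (c.coprod (unitPhase.comp (Units.map (evalAt u.left).toMonoidHom))) (by
    refine Con.conGen_le.2 ?_
    rintro _ _ ⟨p, w, hw, rfl, rfl⟩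
    change c p * unitPhase (Units.map (evalAt u.left).toMonoidHom 1) =
      c 1 * unitPhase (Units.map (evalAt u.left).toMonoidHom w)
    rw [map_one, map_one, map_one, mul_one, one_mul]
    have e : ((Units.map (evalAt u.left).toMonoidHom w : ℂˣ) : ℂ) = C.value x p :=
      (congrArg (evalAt u.left) hw.symm).trans (L.evalAt_etOfTop u _)
    have h0 : C.value x p ≠ 0 := e ▸ Units.ne_zero _
    ext
    rw [coe_unitPhase, e, eq_div_iff (by simpa using h0), mul_comm]
    exact (hc p).symm)

/-- The homomorphism on the stalk of the presheaf pushout induced by `phaseApp`. -/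
def phaseDesc : (L.geomPoint x.hom).presheafFiber.obj (assocPresheaf (chartFun C.f)) ⟶
    CommMonCat.of Circle :=
  (L.geomPoint x.hom).presheafFiberDesc (P := assocPresheaf (chartFun C.f))
    (T := CommMonCat.of Circle) (fun _ u => CommMonCat.ofHom (C.phaseApp x c hc u))
    (fun V W g v => by
      apply ConcreteCategory.hom_ext
      intro a
      obtain ⟨⟨p, s⟩, rfl⟩ := (assocCon (etChart (chartFun C.f) W)).mk'_surjective a
      refine (congrArg (C.phaseApp x c hc v) (assocRes_mk (chartFun C.f) g p s)).trans ?_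
      refine congrArg (fun t => c p * unitPhase t) (Units.ext ?_)
      exact (evalAt_comp _ _ _).symm)

lemma phaseDesc_mk {U : L.X.Etale} (u : L.Lift x.hom U) (p : Multiplicative P) (v : (etRing U)ˣ) :
    C.phaseDesc x c hc ((L.geomPoint x.hom).toPresheafFiber U u (assocPresheaf (chartFun C.f))
      (Assoc.mk (etChart (chartFun C.f) U) (p, v))) =
      c p * unitPhase (Units.map (evalAt u.left).toMonoidHom v) :=
  ConcreteCategory.congr_hom ((L.geomPoint x.hom).toPresheafFiber_presheafFiberDesc
    (P := assocPresheaf (chartFun C.f)) (T := CommMonCat.of Circle) _ _ U u)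
    (Assoc.mk (etChart (chartFun C.f) U) (p, v))

/-- The homomorphism on the stalk of `M` determined by the arguments of the chart. -/
def stalkPhase : L.stalk x.hom →* Circle :=
  (inv (C.stalkIso x.hom) ≫ C.phaseDesc x c hc).hom

lemma stalkPhase_mk {U : L.X.Etale} (u : L.Lift x.hom U) (p : Multiplicative P) (v : (etRing U)ˣ) :
    C.stalkPhase x c hc (C.stalkChart x.hom p * L.germ x.hom u (L.unitSec U v)) =
      c p * unitPhase (Units.map (evalAt u.left).toMonoidHom v) := by
  rw [← C.stalkIso_mk, ← C.phaseDesc_mk x c hc]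
  exact ConcreteCategory.congr_hom (IsIso.hom_inv_id_assoc (C.stalkIso x.hom)
    (C.phaseDesc x c hc)) _

/-- The point of the Kato–Nakayama space with given arguments of the chart. -/
def mkLog : L.KNPoint where
  pt := x
  c := Algebra.GrothendieckGroup.lift (C.stalkPhase x c hc)
  norm U u v := by
    refine (congrArg (fun z : Circle => (z : ℂ)) ?_ : _ = ((unitPhase
      (Units.map (evalAt u.left).toMonoidHom v) : Circle) : ℂ))
    refine (DFunLike.congr_fun (Algebra.GrothendieckGroup.lift.symm_apply_apply _) _).trans ?_
    have := C.stalkPhase_mk x c hc u 1 v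
    rwa [map_one, map_one, one_mul, one_mul] at this

lemma phase_mkLog (p : Multiplicative P) : C.phase (C.mkLog x c hc) p = c p := by
  refine (DFunLike.congr_fun (Algebra.GrothendieckGroup.lift.symm_apply_apply
    (C.stalkPhase x c hc)) _).trans ?_
  have := C.stalkPhase_mk x c hc (L.topLift x.hom) p 1
  rwa [map_one, map_one, map_one, map_one, mul_one, mul_one] at this

end Construct

end KatoChart

section EvalOn

variable {X Y : Scheme.{0}}

/-- The value at a `ℂ`-point of a function on an open subset containing it. -/
def evalOn (x : Spec (CommRingCat.of ℂ) ⟶ X) (U : X.Opens) (h : ⊤ ≤ x ⁻¹ᵁ U) : Γ(X, U) →+* ℂ :=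
  (Scheme.ΓSpecIso (CommRingCat.of ℂ)).hom.hom.comp (x.appLE U ⊤ h).hom

lemma evalOn_top (x : Spec (CommRingCat.of ℂ) ⟶ X) (a : Γ(X, ⊤)) :
    evalOn x ⊤ le_rfl a = evalAt x a := by
  have : x.appLE ⊤ ⊤ le_rfl = x.appTop := Scheme.Hom.appLE_eq_app x
  exact congrArg (fun t => (Scheme.ΓSpecIso (CommRingCat.of ℂ)).hom.hom (t.hom a)) this

lemma evalOn_res (x : Spec (CommRingCat.of ℂ) ⟶ X) {U V : X.Opens} (i : op V ⟶ op U)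
    (h : ⊤ ≤ x ⁻¹ᵁ U) (h' : ⊤ ≤ x ⁻¹ᵁ V) (a : Γ(X, V)) :
    evalOn x U h (X.presheaf.map i a) = evalOn x V h' a :=
  congrArg (Scheme.ΓSpecIso (CommRingCat.of ℂ)).hom.hom
    (ConcreteCategory.congr_hom (x.map_appLE h i) a)

lemma evalOn_comp (x : Spec (CommRingCat.of ℂ) ⟶ X) (g : X ⟶ Y) {U : X.Opens} {V : Y.Opens}
    (e : U ≤ g ⁻¹ᵁ V) (h : ⊤ ≤ x ⁻¹ᵁ U) (h' : ⊤ ≤ (x ≫ g) ⁻¹ᵁ V) (a : Γ(Y, V)) :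
    evalOn x U h (g.appLE V U e a) = evalOn (x ≫ g) V h' a :=
  congrArg (Scheme.ΓSpecIso (CommRingCat.of ℂ)).hom.hom
    (ConcreteCategory.congr_hom (Scheme.Hom.appLE_comp_appLE x g V U ⊤ e h) a)

lemma evalOn_comp_app (x : Spec (CommRingCat.of ℂ) ⟶ X) (g : X ⟶ Y) {V : Y.Opens}
    (h : ⊤ ≤ x ⁻¹ᵁ (g ⁻¹ᵁ V)) (h' : ⊤ ≤ (x ≫ g) ⁻¹ᵁ V) (a : Γ(Y, V)) :
    evalOn x (g ⁻¹ᵁ V) h (g.app V a) = evalOn (x ≫ g) V h' a := by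
  rw [← evalOn_comp x g le_rfl h h', Scheme.Hom.appLE_eq_app]

lemma evalOn_congr {x y : Spec (CommRingCat.of ℂ) ⟶ X} (e : x = y) {U : X.Opens}
    (h : ⊤ ≤ x ⁻¹ᵁ U) (h' : ⊤ ≤ y ⁻¹ᵁ U) (a : Γ(X, U)) : evalOn x U h a = evalOn y U h' a := by
  subst e
  rfl

lemma top_le_preimage_iff (x : Spec (CommRingCat.of ℂ) ⟶ X) (U : X.Opens) :
    ⊤ ≤ x ⁻¹ᵁ U ↔ x default ∈ U := by
  refine ⟨fun h => h (x := default) trivial, fun h z _ => ?_⟩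
  rw [Subsingleton.elim z default]
  exact h

lemma top_le_preimage_basicOpen_iff (x : Spec (CommRingCat.of ℂ) ⟶ X) {U : X.Opens}
    (h : ⊤ ≤ x ⁻¹ᵁ U) (g : Γ(X, U)) :
    ⊤ ≤ x ⁻¹ᵁ X.basicOpen g ↔ evalOn x U h g ≠ 0 := by
  have hle : X.basicOpen g ≤ U := X.basicOpen_le g
  constructor
  · intro h'
    have h1 := (X.toRingedSpace.isUnit_res_basicOpen g).map (evalOn x _ h')
    exact (evalOn_res x (homOfLE hle).op h' h g ▸ h1.ne_zero :)
  · intro h0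
    have h1 : IsUnit (x.appLE U ⊤ h g) :=
      (isUnit_map_iff (Scheme.ΓSpecIso (CommRingCat.of ℂ)).commRingCatIsoToRingEquiv _).1
        (isUnit_iff_ne_zero.2 h0)
    have h2 := Scheme.basicOpen_of_isUnit _ h1
    rw [Scheme.basicOpen_appLE] at h2
    exact h2.ge.trans inf_le_right

lemma exists_lift_iff (x : Spec (CommRingCat.of ℂ) ⟶ X) (U : X.Opens) (h : Γ((U : Scheme.{0}), ⊤))
    (D : Set ℂ) :
    (∃ u : Spec (CommRingCat.of ℂ) ⟶ (U : Scheme.{0}), u ≫ U.ι = x ∧ evalAt u h ∈ D) ↔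
      ∃ hx : ⊤ ≤ x ⁻¹ᵁ U, evalOn x U hx (U.topIso.hom h) ∈ D := by
  have key (u : Spec (CommRingCat.of ℂ) ⟶ (U : Scheme.{0})) (hx : ⊤ ≤ (u ≫ U.ι) ⁻¹ᵁ U) :
      evalOn (u ≫ U.ι) U hx (U.topIso.hom h) = evalAt u h := by
    have e : (⊤ : (U : Scheme.{0}).Opens) ≤ U.ι ⁻¹ᵁ U := by rw [Scheme.Opens.ι_preimage_self]
    rw [← evalOn_comp u U.ι e le_rfl, ← evalOn_top]
    refine congrArg (evalOn u ⊤ le_rfl) ?_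
    have h1 : U.topIso.hom ≫ U.ι.appLE U ⊤ e = 𝟙 _ := by
      simp only [Scheme.Opens.topIso_hom, Scheme.Opens.ι_appLE]
      exact (X.presheaf.map_comp _ _).symm.trans (X.presheaf.map_id _)
    exact ConcreteCategory.congr_hom h1 h
  constructor
  · rintro ⟨u, rfl, hD⟩
    have hx : ⊤ ≤ (u ≫ U.ι) ⁻¹ᵁ U := by
      rw [top_le_preimage_iff, Scheme.Hom.comp_apply]
      exact (u default).2
    exact ⟨hx, by rwa [key u hx]⟩
  · rintro ⟨hx, hD⟩
    have hr : Set.range x ⊆ Set.range U.ι := by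
      rw [Scheme.Opens.range_ι]
      rintro _ ⟨z, rfl⟩
      exact hx (x := z) trivial
    refine ⟨IsOpenImmersion.lift U.ι x hr, IsOpenImmersion.lift_fac _ _ _, ?_⟩
    have hx' : ⊤ ≤ (IsOpenImmersion.lift U.ι x hr ≫ U.ι) ⁻¹ᵁ U := by
      rwa [IsOpenImmersion.lift_fac]
    rw [← key _ hx']
    convert hD
    exact IsOpenImmersion.lift_fac _ _ _

end EvalOn

section Analytic

variable {X Y : Scheme.{0}} {s : X ⟶ Spec (CommRingCat.of ℂ)} {t : Y ⟶ Spec (CommRingCat.of ℂ)}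

lemma isOpen_evalOn (U : X.Opens) (h : Γ(X, U)) {D : Set ℂ} (hD : IsOpen D) :
    IsOpen {x : CPoint s | ∃ hx : ⊤ ≤ x.hom ⁻¹ᵁ U, evalOn x.hom U hx h ∈ D} := by
  refine TopologicalSpace.isOpen_generateFrom_of_mem ⟨U, U.topIso.inv h, D, hD, ?_⟩
  ext x
  refine Iff.trans ?_ (exists_lift_iff x.hom U (U.topIso.inv h) D).symm
  have : U.topIso.hom (U.topIso.inv h) = h :=
    ConcreteCategory.congr_hom U.topIso.inv_hom_id h
  rw [this]
  rfl

lemma isOpen_setOf_mem (U : X.Opens) : IsOpen {x : CPoint s | ⊤ ≤ x.hom ⁻¹ᵁ U} := by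
  have := isOpen_evalOn (s := s) U 0 isOpen_univ
  simpa using this

lemma continuous_cPoint {T : Type*} [TopologicalSpace T] {F : T → CPoint s}
    (hF : ∀ (U : X.Opens) (h : Γ(X, U)) (D : Set ℂ), IsOpen D →
      IsOpen {z | ∃ hx : ⊤ ≤ (F z).hom ⁻¹ᵁ U, evalOn (F z).hom U hx h ∈ D}) : Continuous F := by
  refine continuous_generateFrom_iff.2 ?_
  rintro _ ⟨U, h, D, hD, rfl⟩
  convert hF U (U.topIso.hom h) D hD using 1
  ext z
  exact exists_lift_iff (F z).hom U h D

lemma continuous_evalAt (a : Γ(X, ⊤)) : Continuous fun x : CPoint s => evalAt x.hom a := by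
  refine continuous_def.2 fun D hD => ?_
  convert isOpen_evalOn (s := s) ⊤ a hD using 1
  ext x
  exact ⟨fun h => ⟨le_rfl, by rwa [evalOn_top]⟩, fun ⟨_, h⟩ => by rwa [evalOn_top] at h⟩

lemma continuous_of_comp_hom {F : CPoint s → CPoint t} (g : X ⟶ Y)
    (hF : ∀ x, (F x).hom = x.hom ≫ g) : Continuous F := by
  refine continuous_cPoint fun U h D hD => ?_
  convert isOpen_evalOn (s := s) (g ⁻¹ᵁ U) (g.app U h) hD using 1
  ext x
  have hx : (⊤ ≤ (F x).hom ⁻¹ᵁ U) ↔ ⊤ ≤ x.hom ⁻¹ᵁ (g ⁻¹ᵁ U) := by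
    rw [top_le_preimage_iff, top_le_preimage_iff, hF, Scheme.Hom.comp_apply]
    rfl
  have key (h1) (h2) : evalOn (F x).hom U h1 h = evalOn x.hom (g ⁻¹ᵁ U) h2 (g.app U h) := by
    rw [evalOn_comp_app x.hom g h2 (hF x ▸ h1)]
    exact evalOn_congr (hF x) _ _ _
  exact ⟨fun ⟨h1, h2⟩ => ⟨hx.1 h1, key h1 (hx.1 h1) ▸ h2⟩,
    fun ⟨h1, h2⟩ => ⟨hx.2 h1, (key (hx.2 h1) h1).symm ▸ h2⟩⟩

/-- The value at a `ℂ`-point of a function on an open subset, extended by zero. -/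
def evalExt (U : X.Opens) (a : Γ(X, U)) (x : Spec (CommRingCat.of ℂ) ⟶ X) : ℂ :=
  open Classical in if h : ⊤ ≤ x ⁻¹ᵁ U then evalOn x U h a else 0

lemma evalExt_of_mem {U : X.Opens} (a : Γ(X, U)) {x : Spec (CommRingCat.of ℂ) ⟶ X}
    (h : ⊤ ≤ x ⁻¹ᵁ U) : evalExt U a x = evalOn x U h a := dif_pos h

lemma continuousAt_evalExt {x : CPoint s} {U : X.Opens} (a : Γ(X, U)) (h : ⊤ ≤ x.hom ⁻¹ᵁ U) :
    ContinuousAt (fun x : CPoint s => evalExt U a x.hom) x := by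
  refine (continuousAt_def).2 fun D hD => ?_
  obtain ⟨D', hD', hO, hm⟩ := mem_nhds_iff.1 hD
  refine Filter.mem_of_superset ((isOpen_evalOn (s := s) U a hO).mem_nhds ⟨h, ?_⟩) ?_
  · simpa only [evalExt_of_mem a h] using hm
  · rintro y ⟨hy, hy'⟩
    exact hD' (Set.mem_of_eq_of_mem (evalExt_of_mem a hy) hy')

end Analytic

lemma subring_eq_top_of_isPushout {A B C D : CommRingCat.{0}} {f : A ⟶ B} {g : A ⟶ C} {i : B ⟶ D}
    {j : C ⟶ D} (h : IsPushout f g i j) (R : Subring D) (hi : ∀ b, i b ∈ R) (hj : ∀ c, j c ∈ R) :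
    R = ⊤ := by
  let i' : B ⟶ CommRingCat.of R := CommRingCat.ofHom (i.hom.codRestrict R hi)
  let j' : C ⟶ CommRingCat.of R := CommRingCat.ofHom (j.hom.codRestrict R hj)
  have w : f ≫ i' = g ≫ j' := by
    ext a
    exact ConcreteCategory.congr_hom h.w a
  have e : h.desc i' j' w ≫ CommRingCat.ofHom R.subtype = 𝟙 D := by
    apply h.hom_ext
    · rw [h.inl_desc_assoc, Category.comp_id]
      rfl
    · rw [h.inr_desc_assoc, Category.comp_id]
      rfl
  refine eq_top_iff.2 fun d _ => ?_
  have : ((h.desc i' j' w d : R) : D) = d := ConcreteCategory.congr_hom e d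
  rw [← this]
  exact Subtype.property _

section Pullback

variable {X Y S T : Scheme.{0}} {p : Y ⟶ X} {q : Y ⟶ T} {f : X ⟶ S} {g : T ⟶ S}
  {s : X ⟶ Spec (CommRingCat.of ℂ)} {t : Y ⟶ Spec (CommRingCat.of ℂ)}

/-- The analytic topology of a fibre product over an affine scheme with an affine scheme is
induced by the two projections. -/
lemma continuous_of_isPullback [IsAffine S] [IsAffine T] (H : IsPullback p q f g)
    {Z : Type*} [TopologicalSpace Z] {F : Z → CPoint t} {G : Z → CPoint s} (hG : Continuous G)
    (hFG : ∀ z, (F z).hom ≫ p = (G z).hom)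
    (hq : ∀ a : Γ(T, ⊤), Continuous fun z => evalAt ((F z).hom ≫ q) a) : Continuous F := by
  have hmem (z : Z) (V : X.Opens) : ⊤ ≤ (F z).hom ⁻¹ᵁ (p ⁻¹ᵁ V) ↔ ⊤ ≤ (G z).hom ⁻¹ᵁ V := by
    rw [top_le_preimage_iff, top_le_preimage_iff, ← hFG, Scheme.Hom.comp_apply]
    rfl
  refine continuous_cPoint fun U h D hD => isOpen_iff_mem_nhds.2 ?_
  rintro z₀ ⟨hU, hzD⟩
  obtain ⟨_, ⟨V, hV, rfl⟩, hxV, -⟩ := X.isBasis_affineOpens.exists_subset_of_mem_open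
    (Set.mem_univ ((G z₀).hom default)) isOpen_univ
  have hzV : ⊤ ≤ (G z₀).hom ⁻¹ᵁ V := (top_le_preimage_iff _ _).2 hxV
  have hzW : ⊤ ≤ (F z₀).hom ⁻¹ᵁ (p ⁻¹ᵁ V) := (hmem _ _).2 hzV
  have hnear : ∀ᶠ z in nhds z₀, ⊤ ≤ (F z).hom ⁻¹ᵁ (p ⁻¹ᵁ V) := by
    simp only [hmem]
    exact ((isOpen_setOf_mem V).preimage hG).mem_nhds hzV
  have : IsAffineHom g := inferInstance
  have : IsAffineHom p := MorphismProperty.of_isPullback H.flip this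
  have hW : IsAffineOpen (p ⁻¹ᵁ V) := hV.preimage p
  have hW' : p ⁻¹ᵁ V = p ⁻¹ᵁ V ⊓ q ⁻¹ᵁ ⊤ := (inf_top_eq _).symm
  have := isIso_pushoutSection_of_isAffineOpen H (US := ⊤) (UT := ⊤) (UX := V) (UY := p ⁻¹ᵁ V)
    le_top le_top hW' (isAffineOpen_top S) (isAffineOpen_top T) hV
  have hpush := (isIso_pushoutSection_iff H (US := ⊤) (UT := ⊤) (UX := V) (UY := p ⁻¹ᵁ V)
    le_top le_top hW').1 this
  have hcongr (a : Γ(Y, p ⁻¹ᵁ V)) {k : Z → ℂ} (hk : ContinuousAt k z₀)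
      (h : ∀ z (hz : ⊤ ≤ (F z).hom ⁻¹ᵁ (p ⁻¹ᵁ V)), k z = evalOn (F z).hom _ hz a) :
      ContinuousAt (fun z => evalExt (p ⁻¹ᵁ V) a (F z).hom) z₀ :=
    hk.congr (hnear.mono fun z hz => (h z hz).trans (evalExt_of_mem a hz).symm)
  let R : Subring Γ(Y, p ⁻¹ᵁ V) :=
    { carrier := {a | ContinuousAt (fun z => evalExt (p ⁻¹ᵁ V) a (F z).hom) z₀}
      mul_mem' := fun {a b} (ha : ContinuousAt (fun z => evalExt (p ⁻¹ᵁ V) a (F z).hom) z₀)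
          (hb : ContinuousAt (fun z => evalExt (p ⁻¹ᵁ V) b (F z).hom) z₀) =>
        hcongr _ (ha.mul hb) fun z hz => by
          rw [Pi.mul_apply, evalExt_of_mem _ hz, evalExt_of_mem _ hz, map_mul]
      add_mem' := fun {a b} (ha : ContinuousAt (fun z => evalExt (p ⁻¹ᵁ V) a (F z).hom) z₀)
          (hb : ContinuousAt (fun z => evalExt (p ⁻¹ᵁ V) b (F z).hom) z₀) =>
        hcongr _ (ha.add hb) fun z hz => by
          rw [Pi.add_apply, evalExt_of_mem _ hz, evalExt_of_mem _ hz, map_add]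
      one_mem' := hcongr 1 continuousAt_const fun z hz => (map_one (evalOn (F z).hom _ hz)).symm
      zero_mem' := hcongr 0 continuousAt_const fun z hz => (map_zero (evalOn (F z).hom _ hz)).symm
      neg_mem' := fun {a} (ha : ContinuousAt (fun z => evalExt (p ⁻¹ᵁ V) a (F z).hom) z₀) => hcongr _ ha.neg fun z hz => by
        rw [Pi.neg_apply, evalExt_of_mem _ hz, map_neg] }
  have hR : R = ⊤ := by
    refine subring_eq_top_of_isPushout hpush R (fun b => ?_) (fun c => ?_)
    · refine hcongr _ ((continuousAt_evalExt b hzV).comp (f := G) hG.continuousAt) fun z hz => ?_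
      have hz' := (hmem z V).1 hz
      refine (evalExt_of_mem b hz').trans ?_
      rw [evalOn_comp (F z).hom p le_rfl hz (hFG z ▸ hz')]
      exact evalOn_congr (hFG z).symm _ _ _
    · refine hcongr _ (hq c).continuousAt fun z hz => ?_
      rw [evalOn_comp (F z).hom q _ hz le_rfl, evalOn_top]
  have hcont (a : Γ(Y, p ⁻¹ᵁ V)) : ContinuousAt (fun z => evalExt (p ⁻¹ᵁ V) a (F z).hom) z₀ :=
    (hR ▸ trivial : a ∈ R)
  obtain ⟨b, hb, hzb⟩ := hW.exists_basicOpen_le ⟨(F z₀).hom default, (top_le_preimage_iff _ _).1 hU⟩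
    ((top_le_preimage_iff _ _).1 hzW)
  have hb0 := (top_le_preimage_basicOpen_iff _ hzW b).1 ((top_le_preimage_iff _ _).2 hzb)
  have hloc := hW.isLocalization_basicOpen b
  obtain ⟨⟨a, ⟨_, k, rfl⟩⟩, hak⟩ := IsLocalization.surj (Submonoid.powers b)
    (Y.presheaf.map (homOfLE hb).op h)
  have hb1 : evalExt (p ⁻¹ᵁ V) b (F z₀).hom ≠ 0 := by rwa [evalExt_of_mem b hzW]
  have hnear' : ∀ᶠ z in nhds z₀, evalExt (p ⁻¹ᵁ V) b (F z).hom ≠ 0 :=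
    (hcont b).eventually_ne hb1
  have hdiv : ∀ z, ⊤ ≤ (F z).hom ⁻¹ᵁ (p ⁻¹ᵁ V) → evalExt (p ⁻¹ᵁ V) b (F z).hom ≠ 0 →
      ∃ hx : ⊤ ≤ (F z).hom ⁻¹ᵁ U, evalOn (F z).hom U hx h =
        evalExt (p ⁻¹ᵁ V) a (F z).hom / evalExt (p ⁻¹ᵁ V) b (F z).hom ^ k := by
    intro z hz hz'
    rw [evalExt_of_mem _ hz] at hz'
    rw [evalExt_of_mem _ hz, evalExt_of_mem _ hz]
    have hbz := (top_le_preimage_basicOpen_iff _ hz b).2 hz'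
    have hx : ⊤ ≤ (F z).hom ⁻¹ᵁ U :=
      (top_le_preimage_iff _ _).2 (hb ((top_le_preimage_iff _ _).1 hbz))
    refine ⟨hx, ?_⟩
    rw [eq_div_iff (pow_ne_zero k hz')]
    have hb' : Y.basicOpen b ≤ p ⁻¹ᵁ V := Y.basicOpen_le b
    have e1 := congrArg (evalOn (F z).hom _ hbz) hak
    rw [map_mul, evalOn_res _ _ hbz hx] at e1
    have e2 (r : Γ(Y, p ⁻¹ᵁ V)) : evalOn (F z).hom _ hbz (algebraMap _ Γ(Y, Y.basicOpen b) r) =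
        evalOn (F z).hom _ hz r := evalOn_res _ (homOfLE hb').op hbz hz r
    rw [e2, e2] at e1
    exact (congrArg _ (map_pow _ b k).symm).trans e1
  have hcd := (hcont a).div ((hcont b).pow k) (pow_ne_zero k hb1)
  have hD' : ∀ᶠ z in nhds z₀,
      evalExt (p ⁻¹ᵁ V) a (F z).hom / evalExt (p ⁻¹ᵁ V) b (F z).hom ^ k ∈ D := by
    refine hcd.eventually_mem (hD.mem_nhds ?_)
    obtain ⟨_, he⟩ := hdiv z₀ hzW hb1
    exact Set.mem_of_eq_of_mem he.symm hzD
  filter_upwards [hnear, hnear', hD'] with z h1 h2 h3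
  obtain ⟨hx, he⟩ := hdiv z h1 h2
  exact ⟨hx, he ▸ h3⟩

end Pullback

section SpecPoints

variable {X : Scheme.{0}} {R : Type} [CommRing R]

lemma evalAt_specPullback_comp (x : Spec (CommRingCat.of ℂ) ⟶ X)
    (f : X ⟶ Spec (CommRingCat.of R)) (r : R) :
    evalAt x (specPullback f r) =
      evalAt (x ≫ f) ((Scheme.ΓSpecIso (CommRingCat.of R)).inv.hom r) :=
  (evalAt_comp x f _).symm

lemma evalAt_specMap (k : R →+* ℂ) (r : R) :
    evalAt (Spec.map (CommRingCat.ofHom k)) ((Scheme.ΓSpecIso (CommRingCat.of R)).inv.hom r) =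
      k r := by
  have h := ConcreteCategory.congr_hom
    (Scheme.ΓSpecIso_inv_naturality (CommRingCat.ofHom k)) r
  refine (congrArg (Scheme.ΓSpecIso (CommRingCat.of ℂ)).hom.hom h.symm).trans ?_
  exact ConcreteCategory.congr_hom (Scheme.ΓSpecIso (CommRingCat.of ℂ)).inv_hom_id (k r)

lemma evalAt_id (r : ℂ) :
    evalAt (𝟙 _) ((Scheme.ΓSpecIso (CommRingCat.of ℂ)).inv.hom r) = r := by
  have h := evalAt_specMap (RingHom.id ℂ) r
  rw [CommRingCat.ofHom_id, Spec.map_id] at h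
  exact h

lemma spec_point_ext {x y : Spec (CommRingCat.of ℂ) ⟶ Spec (CommRingCat.of R)}
    (h : ∀ r, evalAt x ((Scheme.ΓSpecIso (CommRingCat.of R)).inv.hom r) =
      evalAt y ((Scheme.ΓSpecIso (CommRingCat.of R)).inv.hom r)) : x = y := by
  refine ext_of_isAffine ?_
  ext a
  have ha : (Scheme.ΓSpecIso (CommRingCat.of R)).inv.hom
      ((Scheme.ΓSpecIso (CommRingCat.of R)).hom.hom a) = a :=
    ConcreteCategory.congr_hom (Scheme.ΓSpecIso (CommRingCat.of R)).hom_inv_id a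
  have h1 := h ((Scheme.ΓSpecIso (CommRingCat.of R)).hom.hom a)
  rw [ha] at h1
  exact (Scheme.ΓSpecIso (CommRingCat.of ℂ)).commRingCatIsoToRingEquiv.injective h1

/-- A ring homomorphism on a monoid algebra is determined by the constants and the monomials. -/
lemma monoidAlgebra_ringHom_ext {Q S : Type} [AddCommMonoid Q] [CommRing S]
    {k l : AddMonoidAlgebra ℂ Q →+* S}
    (h0 : ∀ r : ℂ, k (algebraMap ℂ _ r) = l (algebraMap ℂ _ r))
    (h1 : ∀ q, k (AddMonoidAlgebra.of ℂ Q q) = l (AddMonoidAlgebra.of ℂ Q q)) (a) :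
    k a = l a := by
  induction a using AddMonoidAlgebra.induction_on with
  | of q => exact h1 q
  | add a b ha hb => rw [map_add, map_add, ha, hb]
  | smul r a ha => rw [Algebra.smul_def, map_mul, map_mul, ha, h0]

lemma evalAt_specPullback_str {s : X ⟶ Spec (CommRingCat.of ℂ)} (x : CPoint s) (r : ℂ) :
    evalAt x.hom (specPullback s r) = r := by
  rw [evalAt_specPullback_comp, x.isOver, evalAt_id]

lemma evalAt_specPullback_algebraMap {Q : Type} [AddCommMonoid Q] (f : X ⟶ specMonoid Q)
    (x : CPoint (f ≫ specMonoidStr Q)) (r : ℂ) :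
    evalAt x.hom (specPullback f (algebraMap ℂ (AddMonoidAlgebra ℂ Q) r)) = r := by
  rw [← specPullback_map]
  exact evalAt_specPullback_str x r

end SpecPoints

namespace KatoChart

variable {L : LogScheme} {P : Type} [AddCommMonoid P] (C : KatoChart L P)

lemma continuous_value (p : Multiplicative P) : Continuous fun x : L.An => C.value x p :=
  continuous_evalAt _

lemma evalAt_specPullback_f (x : L.An) (r : ℂ) :
    evalAt x.hom (specPullback C.f (algebraMap ℂ (AddMonoidAlgebra ℂ P) r)) = r := by
  rw [← specPullback_map]
  refine (congrArg (fun t => evalAt x.hom (specPullback t r)) C.w).trans ?_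
  exact evalAt_specPullback_str x r

section Root

variable (n : ℕ)

lemma value_mapAn (x : (C.root n).An) (p : Multiplicative P) :
    C.value ((C.rootMap n).mapAn x) p =
      (C.rootChart n).value x ((RootMonoid.incl n P).toMultiplicative p) := by
  refine (evalAt_comp _ _ _).trans ?_
  refine congrArg (evalAt x.hom) ((C.rootMap_fun n p).trans ?_)
  rw [MonoidHom.one_apply, Units.val_one, mul_one]
  rfl

lemma continuous_mapAn : Continuous (C.rootMap n).mapAn :=
  continuous_of_comp_hom (pullback.fst C.f (rootSpec n P)) fun _ => rfl

variable {n}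

lemma root_ext {x y : (C.root n).An} (h : (C.rootMap n).mapAn x = (C.rootMap n).mapAn y)
    (hv : ∀ q, (C.rootChart n).value x q = (C.rootChart n).value y q) : x = y := by
  refine CPoint.ext (pullback.hom_ext (congrArg CPoint.hom h) (spec_point_ext fun r => ?_))
  rw [← evalAt_specPullback_comp, ← evalAt_specPullback_comp]
  refine monoidAlgebra_ringHom_ext (k := (evalAt x.hom).comp (specPullback (C.rootProj n)))
    (l := (evalAt y.hom).comp (specPullback (C.rootProj n))) (fun r => ?_) hv r
  exact (evalAt_specPullback_algebraMap (C.rootProj n) x r).trans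
    (evalAt_specPullback_algebraMap (C.rootProj n) y r).symm

lemma continuous_root {Z : Type*} [TopologicalSpace Z] {F : Z → (C.root n).An}
    (h : Continuous fun z => (C.rootMap n).mapAn (F z))
    (hv : ∀ q, Continuous fun z => (C.rootChart n).value (F z) q) : Continuous F := by
  refine continuous_of_isPullback (IsPullback.of_hasPullback C.f (rootSpec n P)) h
    (fun _ => rfl) fun a => ?_
  obtain ⟨b, rfl⟩ : ∃ b, (Scheme.ΓSpecIso (CommRingCat.of
      (AddMonoidAlgebra ℂ (RootMonoid n P)))).inv.hom b = a :=
    ⟨_, ConcreteCategory.congr_hom (Scheme.ΓSpecIso (CommRingCat.of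
      (AddMonoidAlgebra ℂ (RootMonoid n P)))).hom_inv_id a⟩
  induction b using AddMonoidAlgebra.induction_on with
  | of q => exact hv q
  | add a b ha hb => 
    simp only [map_add]
    exact ha.add hb
  | smul r a ha =>
    simp only [Algebra.smul_def, map_mul]
    refine Continuous.mul ?_ ha
    exact continuous_const.congr fun z =>
      (evalAt_specPullback_algebraMap (C.rootProj n) (F z) r).symm

/-- The point of `X_n` given by a point of `X` and a compatible homomorphism `(1/n)P → ℂ`. -/
def mkRoot (x : L.An) (v : Multiplicative (RootMonoid n P) →* ℂ)
    (hv : ∀ p, v ((RootMonoid.incl n P).toMultiplicative p) = C.value x p) : (C.root n).An where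
  hom := pullback.lift x.hom (Spec.map (CommRingCat.ofHom
      (AddMonoidAlgebra.lift ℂ ℂ (RootMonoid n P) v).toRingHom)) (by
    refine spec_point_ext fun r => ?_
    rw [rootSpec, ← Spec.map_comp, ← CommRingCat.ofHom_comp, evalAt_specMap,
      ← evalAt_specPullback_comp]
    refine monoidAlgebra_ringHom_ext (k := (evalAt x.hom).comp (specPullback C.f)) (l := _)
      (fun r => ?_) (fun p => ?_) r
    · refine (C.evalAt_specPullback_f x r).trans ?_
      exact (((AddMonoidAlgebra.lift ℂ ℂ (RootMonoid n P) v).comp (rootAlg n P)).commutes r).symm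
    · refine (hv p).symm.trans ?_
      refine Eq.trans ?_ (congrArg (AddMonoidAlgebra.lift ℂ ℂ (RootMonoid n P) v)
        (rootAlg_of n P p)).symm
      exact (AddMonoidAlgebra.lift_of _ _).symm)
  isOver := by
    rw [pullback.lift_snd_assoc, specMonoidStr, ← Spec.map_comp, ← CommRingCat.ofHom_comp,
      ← Spec.map_id]
    congr 2
    exact (AddMonoidAlgebra.lift ℂ ℂ (RootMonoid n P) v).comp_algebraMap

section

variable (x : L.An) (v : Multiplicative (RootMonoid n P) →* ℂ)
  (hv : ∀ p, v ((RootMonoid.incl n P).toMultiplicative p) = C.value x p)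

lemma mapAn_mkRoot : (C.rootMap n).mapAn (C.mkRoot x v hv) = x :=
  CPoint.ext (pullback.lift_fst _ _ _)

lemma value_mkRoot (q : Multiplicative (RootMonoid n P)) :
    (C.rootChart n).value (C.mkRoot x v hv) q = v q := by
  refine (evalAt_specPullback_comp _ _ _).trans ?_
  refine (congrArg (fun t => evalAt t _) (pullback.lift_snd _ _ _)).trans ?_
  exact (evalAt_specMap _ _).trans (AddMonoidAlgebra.lift_of _ _)

end

lemma mapAn_actAn (χ : RootMu n P) (x : (C.root n).An) :
    (C.rootMap n).mapAn (C.actAn χ x) = (C.rootMap n).mapAn x :=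
  CPoint.ext ((Category.assoc _ _ _).trans
    (congrArg (fun t => x.hom ≫ t) (pullback.lift_fst _ _ _)))

lemma evalAt_charFun (χ : RootMu n P) (x : (C.root n).An)
    (q : Multiplicative (RootMonoid n P)) :
    evalAt x.hom (C.charFun χ q).1 = (χ.char q : ℂ) :=
  evalAt_specPullback_str x _

lemma value_actAn (χ : RootMu n P) (x : (C.root n).An) (q : Multiplicative (RootMonoid n P)) :
    (C.rootChart n).value (C.actAn χ x) q = (C.rootChart n).value x q * (χ.char q : ℂ) := by
  refine (evalAt_comp _ _ _).trans ?_
  refine (congrArg (evalAt x.hom) (C.actScheme_fun χ q)).trans ?_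
  rw [map_mul, C.evalAt_charFun]
  rfl

end Root

section Phase

lemma germ_toAssocLog {X : Scheme.{0}} (s : X ⟶ Spec (CommRingCat.of ℂ)) {Q : Type} [CommMonoid Q]
    (a : Q →* Γ(X, ⊤)) (x : Spec (CommRingCat.of ℂ) ⟶ X) {U : X.Etale}
    (u : (LogScheme.ofChart s a).Lift x U) (q : Q) (v : (etRing U)ˣ) :
    (LogScheme.ofChart s a).germ x u
        ((toAssocLog a).app (op U) (Assoc.mk (etChart a U) (q, v))) =
      (LogScheme.ofChart s a).germ x ((LogScheme.ofChart s a).topLift x)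
        (LogScheme.ofChartSec s a q) *
      (LogScheme.ofChart s a).germ x u ((LogScheme.ofChart s a).unitSec U v) := by
  have h := (LogScheme.ofChart s a).toAssocLog_canonicalMap a (LogScheme.ofChartSec s a)
    (LogScheme.α_ofChartSec s a)
  rw [LogScheme.canonicalMap_ofChart] at h
  have h' : toAssocLog a = _ := (Category.comp_id _).symm.trans h
  rw [h']
  refine (map_mul ((LogScheme.ofChart s a).germ x u) _ _).trans ?_
  exact congrArg (· * _) ((LogScheme.ofChart s a).germ_toEtTop u (LogScheme.ofChartSec s a q))

lemma assocLogMap_toAssocLog_one {X X' : Scheme.{0}} {Q Q' : Type} [CommMonoid Q] [CommMonoid Q']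
    (g : X' ⟶ X) (a : Q →* Γ(X, ⊤)) (a' : Q' →* Γ(X', ⊤)) (θ : Q →* Q')
    (u : Q →* (Γ(X', ⊤))ˣ) (h : ∀ q, g.appTop.hom (a q) = a' (θ q) * u q) (U : X.Etale) (q : Q) :
    (assocLogMap g a a' θ u h).app (op U)
        ((toAssocLog a).app (op U) (Assoc.mk (etChart a U) (q, 1))) =
      (toAssocLog a').app (op ((etalePullback g).obj U))
        (Assoc.mk (etChart a' ((etalePullback g).obj U))
          (θ q, Units.map (etOfTop ((etalePullback g).obj U)).toMonoidHom (u q))) := by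
  refine (ConcreteCategory.congr_hom (NatTrans.congr_app
    (toAssocLog_assocLogMap g a a' θ u h) (op U)) _).trans ?_
  refine congrArg ((toAssocLog a').app (op ((etalePullback g).obj U))).hom ?_
  refine (Assoc.map_mk _ _ _ _ _ (etChart_pullback g a a' θ u h U) (q, 1)).trans ?_
  rw [map_one, mul_one]
  rfl

lemma canonicalMap_toAssocLog_one (p : Multiplicative P) :
    (L.canonicalMap (chartFun C.f) C.β C.compat).app (op (etTop L.X))
      ((toAssocLog (chartFun C.f)).app (op (etTop L.X))
        (Assoc.mk (etChart (chartFun C.f) (etTop L.X)) (p, 1))) = C.β p := by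
  refine (ConcreteCategory.congr_hom (NatTrans.congr_app
    (L.toAssocLog_canonicalMap (chartFun C.f) C.β C.compat) (op (etTop L.X))) _).trans ?_
  refine (L.canonicalApp_mk _ _ C.compat (etTop L.X) p 1).trans ?_
  have h : toEtTop (etTop L.X) = 𝟙 _ := by
    apply (Scheme.Etale.forget L.X).map_injective
    exact Over.mkIdTerminal.hom_ext _ _
  rw [map_one, mul_one, h]
  exact ConcreteCategory.congr_hom (L.M.map_id _) (C.β p)

variable {n : ℕ}

/-- The arguments of the chart at the image of a point, for a morphism to `L` given on the chart by
`p ↦ θ(p) w`. -/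
lemma phase_mapKN {K : LogScheme} {Q : Type} [AddCommMonoid Q] (D : KatoChart K Q)
    (F : LogHom K L) (y : K.KNPoint) (p : Multiplicative P) (q : Multiplicative Q) (z : ℂˣ)
    (h : K.germ y.pt.hom (F.liftPt y.pt.hom (L.topLift (y.pt.hom ≫ F.f)))
      (F.φ.app (op (etTop L.X)) (C.β p)) = D.stalkChart y.pt.hom q *
        K.germ y.pt.hom (F.liftPt y.pt.hom (L.topLift (y.pt.hom ≫ F.f)))
          (K.unitSec ((etalePullback F.f).obj (etTop L.X))
            (Units.map (specPullback (((Scheme.Etale.forget K.X).obj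
              ((etalePullback F.f).obj (etTop L.X))).hom ≫ K.str)).toMonoidHom z))) :
    C.phase (F.mapKN y) p = D.phase y q * unitPhase z := by
  refine (DFunLike.congr_fun (Algebra.GrothendieckGroup.lift.symm_apply_apply
    ((y.c.comp Algebra.GrothendieckGroup.of).comp (F.stalkMap y.pt.hom))) _).trans ?_
  refine (congrArg (fun t => y.c (Algebra.GrothendieckGroup.of t))
    ((F.stalkMap_germ y.pt.hom _ _).trans h)).trans ?_
  rw [map_mul, map_mul]
  refine congrArg (D.phase y q * ·) ((norm_eq_unitPhase y _ _).trans ?_)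
  refine congrArg unitPhase (Units.ext ?_)
  refine (evalAt_specPullback_comp _ _ _).trans ?_
  refine Eq.trans (congrArg (fun t => evalAt t _) ?_) (evalAt_id z)
  refine (Category.assoc _ _ _).symm.trans ?_
  refine Eq.trans (congrArg (· ≫ K.str) ?_) y.pt.isOver
  exact Over.w (F.liftPt y.pt.hom (L.topLift (y.pt.hom ≫ F.f)))

lemma phase_rootMapLog (y : (C.rootChart n).Log) (p : Multiplicative P) :
    C.phase (C.rootMapLog n y) p =
      (C.rootChart n).phase y ((RootMonoid.incl n P).toMultiplicative p) := by
  refine (C.phase_mapKN (C.rootChart n) (C.rootMap n) y p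
    ((RootMonoid.incl n P).toMultiplicative p) 1 ?_).trans (by rw [map_one, mul_one])
  have hs := C.strict
  have h1 : (inv (L.canonicalMap (chartFun C.f) C.β C.compat)).app (op (etTop L.X)) (C.β p) =
      (toAssocLog (chartFun C.f)).app (op (etTop L.X))
        (Assoc.mk (etChart (chartFun C.f) (etTop L.X)) (p, 1)) := by
    refine (congrArg _ (C.canonicalMap_toAssocLog_one p).symm).trans ?_
    exact ConcreteCategory.congr_hom (NatTrans.congr_app
      (IsIso.hom_inv_id (L.canonicalMap (chartFun C.f) C.β C.compat)) (op (etTop L.X))) _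
  have h2 := (congrArg ((assocLogMap (pullback.fst C.f (rootSpec n P)) (chartFun C.f)
      (chartFun (C.rootProj n)) (RootMonoid.incl n P).toMultiplicative 1
      (C.rootMap_fun n)).app (op (etTop L.X))).hom h1).trans
    (assocLogMap_toAssocLog_one _ _ _ _ _ (C.rootMap_fun n) _ p)
  refine (congrArg _ h2).trans ((germ_toAssocLog _ _ _ _ _ _).trans ?_)
  rw [MonoidHom.one_apply, map_one, map_one]
  rfl

lemma phase_actLog (χ : RootMu n P) (y : (C.rootChart n).Log)
    (q : Multiplicative (RootMonoid n P)) :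
    (C.rootChart n).phase (C.actLog χ y) q =
      (C.rootChart n).phase y q * unitPhase (χ.char q) := by
  refine (C.rootChart n).phase_mapKN (C.rootChart n) (C.act χ) y q q (χ.char q) ?_
  have h2 := assocLogMap_toAssocLog_one (C.actScheme χ) (chartFun (C.rootProj n))
    (chartFun (C.rootProj n)) (MonoidHom.id _) (C.charFun χ) (C.actScheme_fun χ) (etTop _) q
  refine (congrArg _ h2).trans ((germ_toAssocLog _ _ _ _ _ _).trans ?_)
  refine congrArg (fun t => (C.rootChart n).stalkChart y.pt.hom q *
    (C.root n).germ y.pt.hom _ ((C.root n).unitSec _ t)) (Units.ext ?_)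
  exact (specPullback_comp _ _ _).symm

end Phase

end KatoChart

namespace RootMonoid

/-- The numerator `p/n ↦ p`. -/
def num (n : ℕ) (P : Type) [AddCommMonoid P] :
    Multiplicative (RootMonoid n P) →* Multiplicative P :=
  MonoidHom.id (Multiplicative P)

lemma num_incl (n : ℕ) (P : Type) [AddCommMonoid P] (p : Multiplicative P) :
    num n P ((incl n P).toMultiplicative p) = p ^ n := rfl

lemma incl_num (n : ℕ) (P : Type) [AddCommMonoid P] (q : Multiplicative (RootMonoid n P)) :
    (incl n P).toMultiplicative (num n P q) = q ^ n := rfl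

end RootMonoid

lemma exists_of_sub {M : Type*} [AddCommMonoid M] (g : Algebra.GrothendieckAddGroup M) :
    ∃ a b : M, g = Algebra.GrothendieckAddGroup.of a - Algebra.GrothendieckAddGroup.of b := by
  obtain ⟨a, ⟨b, hb⟩, rfl⟩ := (AddLocalization.addMonoidOf (⊤ : AddSubmonoid M)).mk'_surjective g
  refine ⟨a, b, ?_⟩
  rw [eq_sub_iff_add_eq]
  exact (AddLocalization.addMonoidOf (⊤ : AddSubmonoid M)).mk'_spec a ⟨b, hb⟩

lemma lift_of {M G : Type*} [AddCommMonoid M] [AddCommGroup G] (f : M →+ G) (a : M) :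
    Algebra.GrothendieckAddGroup.lift f (Algebra.GrothendieckAddGroup.of a) = f a :=
  DFunLike.congr_fun (Algebra.GrothendieckAddGroup.lift.symm_apply_apply f) a

namespace RootMu

variable {n : ℕ} {P : Type} [AddCommMonoid P]

lemma exists_cls_sub (z : RootCoker n P) :
    ∃ a b, z = RootCoker.cls n P a - RootCoker.cls n P b := by
  obtain ⟨g, rfl⟩ := QuotientAddGroup.mk'_surjective _ z
  obtain ⟨a, b, rfl⟩ := exists_of_sub g
  exact ⟨a, b, map_sub _ _ _⟩

lemma toHom_sub (χ : RootMu n P) (a b : RootMonoid n P) :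
    χ.toHom (Multiplicative.ofAdd (RootCoker.cls n P a - RootCoker.cls n P b)) =
      χ.char (Multiplicative.ofAdd a) / χ.char (Multiplicative.ofAdd b) :=
  map_div χ.toHom _ _

lemma char_injective : Function.Injective (char : RootMu n P → _) := by
  intro χ ψ h
  refine MonoidHom.ext (M := Multiplicative (RootCoker n P)) (N := ℂˣ) fun z => ?_
  obtain ⟨a, b, hz⟩ := exists_cls_sub (Multiplicative.toAdd z)
  obtain rfl : z = Multiplicative.ofAdd (RootCoker.cls n P a - RootCoker.cls n P b) := hz
  refine (χ.toHom_sub a b).trans (Eq.trans ?_ (ψ.toHom_sub a b).symm)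
  rw [show χ.char = ψ.char from h]

lemma char_one (q : Multiplicative (RootMonoid n P)) : (1 : RootMu n P).char q = 1 := rfl

lemma char_mul (χ ψ : RootMu n P) (q : Multiplicative (RootMonoid n P)) :
    (χ * ψ).char q = χ.char q * ψ.char q := rfl

lemma char_pow (χ : RootMu n P) (q : Multiplicative (RootMonoid n P)) : χ.char q ^ n = 1 := by
  rw [← map_pow, ← RootMonoid.incl_num]
  exact χ.char_incl _

lemma norm_char (hn : n ≠ 0) (χ : RootMu n P) (q : Multiplicative (RootMonoid n P)) :
    ‖(χ.char q : ℂ)‖ = 1 := by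
  refine Complex.norm_eq_one_of_pow_eq_one (n := n) ?_ hn
  rw [← Units.val_pow_eq_pow_val, char_pow, Units.val_one]

lemma continuous_char (q : Multiplicative (RootMonoid n P)) :
    Continuous fun χ : RootMu n P => χ.char q :=
  (continuous_apply (Multiplicative.ofAdd (RootCoker.cls n P q.toAdd))).comp
    (continuous_induced_dom (f := fun (χ : RootMu n P) (z : Multiplicative (RootCoker n P)) =>
      χ.toHom z))

lemma continuous_of_char {Z : Type*} [TopologicalSpace Z] {F : Z → RootMu n P}
    (h : ∀ q, Continuous fun z => (F z).char q) : Continuous F := by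
  refine continuous_induced_rng.2 (continuous_pi fun z => ?_)
  obtain ⟨a, b, hz⟩ := exists_cls_sub (Multiplicative.toAdd z)
  obtain rfl : z = Multiplicative.ofAdd (RootCoker.cls n P a - RootCoker.cls n P b) := hz
  exact ((h _).div' (h _)).congr fun z => ((F z).toHom_sub a b).symm

/-- A character of `(1/n)P` which is trivial on `P` defines a point of `μ_n(P)`. -/
def ofChar (ψ : Multiplicative (RootMonoid n P) →* ℂˣ)
    (h : ∀ p, ψ ((RootMonoid.incl n P).toMultiplicative p) = 1) : RootMu n P :=
  AddMonoidHom.toMultiplicativeLeft (QuotientAddGroup.lift _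
    (Algebra.GrothendieckAddGroup.lift (MonoidHom.toAdditiveRight ψ)) (by
      have key (p : P) : Algebra.GrothendieckAddGroup.lift (MonoidHom.toAdditiveRight ψ)
          (Algebra.GrothendieckAddGroup.of (RootMonoid.incl n P p)) = 0 :=
        (lift_of _ _).trans (h p)
      rintro _ ⟨a, rfl⟩
      obtain ⟨p, q, rfl⟩ := exists_of_sub a
      rw [map_sub, lift_of, lift_of, AddMonoidHom.mem_ker, map_sub]
      exact (congrArg₂ (· - ·) (key p) (key q)).trans (sub_zero 0)))

lemma char_ofChar (ψ : Multiplicative (RootMonoid n P) →* ℂˣ)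
    (h : ∀ p, ψ ((RootMonoid.incl n P).toMultiplicative p) = 1)
    (q : Multiplicative (RootMonoid n P)) : (ofChar ψ h).char q = ψ q :=
  lift_of (MonoidHom.toAdditiveRight ψ) (Multiplicative.toAdd q)

end RootMu

section Roots

lemma unitPhase_toUnits (z : Circle) : unitPhase (Circle.toUnits z) = z := by
  refine Circle.ext ((coe_unitPhase _).trans ?_)
  rw [Circle.toUnits_apply, Units.val_mk0, Circle.norm_coe, Complex.ofReal_one, div_one]

lemma toUnits_unitPhase {z : ℂˣ} (h : ‖(z : ℂ)‖ = 1) : Circle.toUnits (unitPhase z) = z := by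
  ext
  simp [coe_unitPhase, h]

lemma continuous_unitPhase : Continuous unitPhase := by
  refine Continuous.subtype_mk ?_ _
  refine Units.continuous_val.div (Complex.continuous_ofReal.comp Units.continuous_val.norm) ?_
  intro z
  simp

lemma continuous_toUnits : Continuous Circle.toUnits := by
  refine Units.continuous_iff.2 ⟨continuous_subtype_val, ?_⟩
  exact ((continuous_subtype_val (p := (· ∈ Submonoid.unitSphere ℂ))).comp
    (continuous_inv (G := Circle))).congr fun z => rfl

/-- The `n`-th root of `z` on the circle which is continuous near `z₀`. -/
def circleRoot (n : ℕ) (z₀ z : Circle) : Circle :=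
  Circle.exp ((Complex.arg (z / z₀ : Circle) + Complex.arg z₀) / n)

lemma circleRoot_pow {n : ℕ} (hn : n ≠ 0) (z₀ z : Circle) : circleRoot n z₀ z ^ n = z := by
  have hn' : (n : ℝ) ≠ 0 := Nat.cast_ne_zero.2 hn
  rw [circleRoot, ← Circle.exp_natCast_mul, mul_div_cancel₀ _ hn', Circle.exp_add, Circle.exp_arg,
    Circle.exp_arg, div_mul_cancel]

lemma continuousAt_circleRoot (n : ℕ) {z₀ z : Circle}
    (h : ((z / z₀ : Circle) : ℂ) ∈ Complex.slitPlane) : ContinuousAt (circleRoot n z₀) z := by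
  have h1 : ContinuousAt (fun z : Circle => ((z / z₀ : Circle) : ℂ)) z :=
    (continuous_subtype_val.comp (continuous_id.div_const z₀)).continuousAt
  have h2 : ContinuousAt (fun z : Circle => Complex.arg (z / z₀ : Circle)) z :=
    ContinuousAt.comp (g := Complex.arg) (Complex.continuousAt_arg h) h1
  exact Circle.exp.continuous.continuousAt.comp ((h2.add continuousAt_const).div_const _)

variable {P : Type} [AddCommMonoid P]

lemma free_grothendieck (hfg : AddMonoid.FG P) (hint : ∀ a b c : P, a + c = b + c → a = b)
    (hsat : ∀ (k : ℕ) (a b c : P), 0 < k → k • a = k • b + c → ∃ d : P, a = b + d)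
    (hsharp : ∀ a b : P, a + b = 0 → a = 0) :
    Module.Finite ℤ (Algebra.GrothendieckAddGroup P) ∧
      Module.Free ℤ (Algebra.GrothendieckAddGroup P) := by
  have h1 : Module.Finite ℤ (Algebra.GrothendieckAddGroup P) :=
    Module.Finite.iff_addGroup_fg.2 (AddGroup.fg_iff_addMonoid_fg.2 inferInstance)
  have h2 : IsAddTorsionFree P := ⟨fun k hk a b h => by
    have h : k • a = k • b := h
    obtain ⟨d, hd⟩ := hsat k a b 0 (Nat.pos_of_ne_zero hk) (by rw [add_zero, h])
    obtain ⟨d', hd'⟩ := hsat k b a 0 (Nat.pos_of_ne_zero hk) (by rw [add_zero, h])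
    have h0 : d + d' = 0 := hint _ _ a (by
      rw [zero_add, add_comm d, add_comm _ a, ← add_assoc, ← hd', ← hd])
    rw [hd, hsharp d d' h0, add_zero]⟩
  exact ⟨h1, inferInstance⟩

/-- Families of homomorphisms `P → S¹` have `n`-th roots, continuously near any parameter. -/
lemma exists_local_root (hfg : AddMonoid.FG P) (hint : ∀ a b c : P, a + c = b + c → a = b)
    (hsat : ∀ (k : ℕ) (a b c : P), 0 < k → k • a = k • b + c → ∃ d : P, a = b + d)
    (hsharp : ∀ a b : P, a + b = 0 → a = 0) {n : ℕ} (hn : n ≠ 0)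
    {B : Type*} [TopologicalSpace B] (c : B → Multiplicative P →* Circle)
    (hc : ∀ p, Continuous fun b => c b p) (b₀ : B) :
    ∃ V : Set B, IsOpen V ∧ b₀ ∈ V ∧ ∃ σ : B → Multiplicative P →* Circle,
      (∀ b p, σ b p ^ n = c b p) ∧ ∀ p, ContinuousOn (fun b => σ b p) V := by
  obtain ⟨_, _⟩ := free_grothendieck hfg hint hsat hsharp
  let e := Module.Free.chooseBasis ℤ (Algebra.GrothendieckAddGroup P)
  let ĉ (b : B) : Algebra.GrothendieckAddGroup P →+ Additive Circle :=
    Algebra.GrothendieckAddGroup.lift (MonoidHom.toAdditiveRight (c b))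
  have hof (b : B) (p : P) : ĉ b (Algebra.GrothendieckAddGroup.of p) =
      Additive.ofMul (c b (Multiplicative.ofAdd p)) := lift_of _ p
  have hĉ (a) : Continuous fun b => (ĉ b a).toMul := by
    obtain ⟨p, q, rfl⟩ := exists_of_sub a
    simp only [map_sub, hof]
    exact (hc _).div' (hc _)
  let r (b : B) (i) : Additive Circle :=
    Additive.ofMul (circleRoot n (ĉ b₀ (e i)).toMul (ĉ b (e i)).toMul)
  let σ (b : B) : Multiplicative P →* Circle :=
    AddMonoidHom.toMultiplicativeLeft ((e.constr ℤ (r b)).toAddMonoidHom.comp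
      Algebra.GrothendieckAddGroup.of)
  refine ⟨{b | ∀ i, (((ĉ b (e i)).toMul / (ĉ b₀ (e i)).toMul : Circle) : ℂ) ∈ Complex.slitPlane},
    ?_, fun i => ?_, σ, fun b p => ?_, fun p b hb => ?_⟩
  · rw [Set.ofPred_forall]
    exact isOpen_iInter_of_finite fun i => Complex.isOpen_slitPlane.preimage
      (continuous_subtype_val.comp ((hĉ (e i)).div_const _))
  · rw [div_self']
    exact Complex.one_mem_slitPlane
  · have h1 : n • e.constr ℤ (r b) = (ĉ b).toIntLinearMap := by
      refine e.ext fun i => ?_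
      rw [LinearMap.smul_apply, e.constr_basis]
      exact circleRoot_pow hn _ _
    exact (LinearMap.congr_fun h1 (Algebra.GrothendieckAddGroup.of p.toAdd)).trans (hof b p.toAdd)
  · refine ContinuousAt.continuousWithinAt ?_
    have h1 (b : B) : σ b p = ∏ i, ((r b i).toMul) ^
        (e.equivFun (Algebra.GrothendieckAddGroup.of p.toAdd) i) :=
      e.constr_apply_fintype ℤ (r b) (Algebra.GrothendieckAddGroup.of p.toAdd)
    simp only [h1]
    refine tendsto_finsetProd _ fun i _ => ?_
    refine ContinuousAt.zpow ?_ _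
    exact ContinuousAt.comp (g := circleRoot n _) (continuousAt_circleRoot n (hb i))
      (hĉ (e i)).continuousAt

end Roots

namespace KatoChart

variable {L : LogScheme} {P : Type} [AddCommMonoid P] (C : KatoChart L P)

lemma continuous_polar : Continuous fun x : C.Log => (C.toAn x, C.polar x) :=
  continuous_induced_dom

lemma continuous_toAn : Continuous C.toAn :=
  continuous_fst.comp C.continuous_polar

lemma continuous_phase (p : Multiplicative P) : Continuous fun x : C.Log => C.phase x p :=
  continuous_snd.comp ((continuous_apply p.toAdd).comp (continuous_snd.comp C.continuous_polar))

lemma continuous_log {Z : Type*} [TopologicalSpace Z] {F : Z → C.Log}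
    (h : Continuous fun z => C.toAn (F z)) (hp : ∀ p, Continuous fun z => C.phase (F z) p) :
    Continuous F := by
  refine continuous_induced_rng.2 (h.prodMk (continuous_pi fun p => ?_))
  exact ((C.continuous_value (Multiplicative.ofAdd p)).comp h).nnnorm.prodMk
    (hp (Multiplicative.ofAdd p))

variable {n : ℕ}

section Action

lemma actAn_one (x : (C.root n).An) : C.actAn 1 x = x :=
  C.root_ext (C.mapAn_actAn 1 x) fun q => by
    rw [value_actAn, RootMu.char_one, Units.val_one, mul_one]

lemma actAn_mul (χ ψ : RootMu n P) (x : (C.root n).An) :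
    C.actAn (χ * ψ) x = C.actAn χ (C.actAn ψ x) :=
  C.root_ext (by rw [mapAn_actAn, mapAn_actAn, mapAn_actAn]) fun q => by
    rw [value_actAn, value_actAn, value_actAn, RootMu.char_mul, Units.val_mul, mul_assoc,
      mul_comm (χ.char q : ℂ)]

lemma continuous_actAn :
    Continuous fun y : RootMu n P × (C.root n).An => C.actAn y.1 y.2 := by
  refine C.continuous_root ?_ fun q => ?_
  · simp only [mapAn_actAn]
    exact (C.continuous_mapAn n).comp continuous_snd
  · simp only [value_actAn]
    exact (((C.rootChart n).continuous_value q).comp continuous_snd).mul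
      (Units.continuous_val.comp ((RootMu.continuous_char q).comp continuous_fst))

end Action

section RootLog

lemma toAn_rootMapLog (y : (C.rootChart n).Log) :
    C.toAn (C.rootMapLog n y) = (C.rootMap n).mapAn ((C.rootChart n).toAn y) := rfl

lemma toAn_actLog (χ : RootMu n P) (y : (C.rootChart n).Log) :
    (C.rootChart n).toAn (C.actLog χ y) = C.actAn χ ((C.rootChart n).toAn y) := rfl

/-- The absolute value of `q(y)` at a point `y` of `X_n` is the `n`-th root of that of `(n q)(x)` at
the image `x`. -/
lemma norm_value_root (hn : n ≠ 0) (x : (C.root n).An) (q : Multiplicative (RootMonoid n P)) :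
    ‖(C.rootChart n).value x q‖ =
      ‖C.value ((C.rootMap n).mapAn x) (RootMonoid.num n P q)‖ ^ (n : ℝ)⁻¹ := by
  rw [value_mapAn, RootMonoid.incl_num, map_pow, norm_pow,
    Real.pow_rpow_inv_natCast (norm_nonneg _) hn]

lemma value_rootLog (hn : n ≠ 0) (y : (C.rootChart n).Log)
    (q : Multiplicative (RootMonoid n P)) :
    (C.rootChart n).value ((C.rootChart n).toAn y) q =
      (‖C.value (C.toAn (C.rootMapLog n y)) (RootMonoid.num n P q)‖ ^ (n : ℝ)⁻¹ : ℝ) *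
        ((C.rootChart n).phase y q : ℂ) := by
  rw [toAn_rootMapLog, ← C.norm_value_root hn]
  exact (C.rootChart n).value_eq_norm_mul_phase y q

lemma rootLog_ext (hn : n ≠ 0) {y y' : (C.rootChart n).Log}
    (h : C.rootMapLog n y = C.rootMapLog n y')
    (hp : ∀ q, (C.rootChart n).phase y q = (C.rootChart n).phase y' q) : y = y' := by
  refine (C.rootChart n).log_ext (C.root_ext (congrArg C.toAn h) fun q => ?_) hp
  refine (C.value_rootLog hn y q).trans (Eq.trans ?_ (C.value_rootLog hn y' q).symm)
  rw [h, hp]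

lemma continuous_rootLog (hn : n ≠ 0) {Z : Type*} [TopologicalSpace Z]
    {F : Z → (C.rootChart n).Log} (h : Continuous fun z => C.rootMapLog n (F z))
    (hp : ∀ q, Continuous fun z => (C.rootChart n).phase (F z) q) : Continuous F := by
  refine (C.rootChart n).continuous_log (C.continuous_root (C.continuous_toAn.comp h)
    fun q => ?_) hp
  simp only [C.value_rootLog hn]
  refine (Complex.continuous_ofReal.comp ?_).mul (continuous_subtype_val.comp (hp q))
  exact ((C.continuous_value _).comp (C.continuous_toAn.comp h)).norm.rpow_const
    fun _ => Or.inr (by positivity)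

/-- The homomorphism `(1/n)P → ℂ` with absolute values `|p(x)|^(1/n)` and given arguments. -/
def rootValue (n : ℕ) (x : L.An) (c : Multiplicative (RootMonoid n P) →* Circle) :
    Multiplicative (RootMonoid n P) →* ℂ where
  toFun q := (‖C.value x (RootMonoid.num n P q)‖ ^ (n : ℝ)⁻¹ : ℝ) * (c q : ℂ)
  map_one' := by simp
  map_mul' q r := by
    rw [map_mul, map_mul, map_mul, norm_mul, Real.mul_rpow (norm_nonneg _) (norm_nonneg _),
      Complex.ofReal_mul, Circle.coe_mul]
    ring

section

variable (hn : n ≠ 0) (x : C.Log) (c : Multiplicative (RootMonoid n P) →* Circle)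
  (hc : ∀ p, c ((RootMonoid.incl n P).toMultiplicative p) = C.phase x p)

lemma rootValue_incl (hn : n ≠ 0)
    (hc : ∀ p, c ((RootMonoid.incl n P).toMultiplicative p) = C.phase x p) (p : Multiplicative P) :
    C.rootValue n (C.toAn x) c ((RootMonoid.incl n P).toMultiplicative p) =
      C.value (C.toAn x) p := by
  refine Eq.trans ?_ (C.value_eq_norm_mul_phase x p).symm
  change ((‖C.value x.pt (RootMonoid.num n P _)‖ ^ (n : ℝ)⁻¹ : ℝ) : ℂ) * (c _ : ℂ) = _
  rw [RootMonoid.num_incl, hc, map_pow, norm_pow, Real.pow_rpow_inv_natCast (norm_nonneg _) hn]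

/-- The point of `(X_n)_log` over a point of `X_log` with given arguments. -/
def mkRootLog : (C.rootChart n).Log :=
  (C.rootChart n).mkLog (C.mkRoot (C.toAn x) (C.rootValue n (C.toAn x) c)
    (C.rootValue_incl x c hn hc)) c fun q => by
    rw [C.norm_value_root hn, mapAn_mkRoot, value_mkRoot]
    rfl

lemma phase_mkRootLog (q : Multiplicative (RootMonoid n P)) :
    (C.rootChart n).phase (C.mkRootLog hn x c hc) q = c q :=
  (C.rootChart n).phase_mkLog _ _ _ q

lemma rootMapLog_mkRootLog : C.rootMapLog n (C.mkRootLog hn x c hc) = x :=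
  C.log_ext (C.mapAn_mkRoot _ _ (C.rootValue_incl x c hn hc)) fun p => by
    rw [phase_rootMapLog, phase_mkRootLog, hc]

end

lemma continuous_rootMapLog : Continuous (C.rootMapLog n) := by
  refine C.continuous_log ((C.continuous_mapAn n).comp (C.rootChart n).continuous_toAn)
    fun p => ?_
  simp only [phase_rootMapLog]
  exact (C.rootChart n).continuous_phase _

lemma rootMapLog_actLog (χ : RootMu n P) (y : (C.rootChart n).Log) :
    C.rootMapLog n (C.actLog χ y) = C.rootMapLog n y :=
  C.log_ext (C.mapAn_actAn χ _) fun p => by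
    rw [phase_rootMapLog, phase_rootMapLog, phase_actLog,
      show χ.char ((RootMonoid.incl n P).toMultiplicative p) = 1 from χ.char_incl p.toAdd, map_one,
      mul_one]

lemma continuous_actLog (hn : n ≠ 0) :
    Continuous fun y : RootMu n P × (C.rootChart n).Log => C.actLog y.1 y.2 := by
  refine C.continuous_rootLog hn ?_ fun q => ?_
  · simp only [rootMapLog_actLog]
    exact C.continuous_rootMapLog.comp continuous_snd
  · simp only [phase_actLog]
    exact (((C.rootChart n).continuous_phase q).comp continuous_snd).mul
      (continuous_unitPhase.comp ((RootMu.continuous_char q).comp continuous_fst))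

lemma actLog_one (hn : n ≠ 0) (y : (C.rootChart n).Log) : C.actLog 1 y = y :=
  C.rootLog_ext hn (C.rootMapLog_actLog 1 y) fun q => by
    rw [phase_actLog, RootMu.char_one, map_one, mul_one]

lemma actLog_mul (hn : n ≠ 0) (χ ψ : RootMu n P) (y : (C.rootChart n).Log) :
    C.actLog (χ * ψ) y = C.actLog χ (C.actLog ψ y) :=
  C.rootLog_ext hn (by simp only [rootMapLog_actLog]) fun q => by
    rw [phase_actLog, phase_actLog, phase_actLog, RootMu.char_mul, map_mul, mul_assoc,
      mul_comm (unitPhase (χ.char q))]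

/-- The character of `(1/n)P` by which two points of a fibre of `φ_log` differ. -/
def quotChar (c : Multiplicative (RootMonoid n P) →* Circle) (y : (C.rootChart n).Log)
    (hc : ∀ p, c ((RootMonoid.incl n P).toMultiplicative p) = C.phase (C.rootMapLog n y) p) :
    RootMu n P :=
  RootMu.ofChar (Circle.toUnits.comp ((C.rootChart n).phase y / c)) fun p => by
    rw [MonoidHom.comp_apply, MonoidHom.div_apply, hc, phase_rootMapLog, div_self', map_one]

lemma char_quotChar (c : Multiplicative (RootMonoid n P) →* Circle) (y : (C.rootChart n).Log)
    (hc : ∀ p, c ((RootMonoid.incl n P).toMultiplicative p) = C.phase (C.rootMapLog n y) p)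
    (q : Multiplicative (RootMonoid n P)) :
    (C.quotChar c y hc).char q = Circle.toUnits ((C.rootChart n).phase y q / c q) :=
  RootMu.char_ofChar _ _ q

/-- The trivialization of `φ_log` defined by a continuous choice of `n`-th roots of the arguments
of the chart. -/
def trivialization (hn : n ≠ 0) (V : Set C.Log)
    (σ : C.Log → Multiplicative (RootMonoid n P) →* Circle)
    (hσ : ∀ x p, σ x ((RootMonoid.incl n P).toMultiplicative p) = C.phase x p)
    (hσc : ∀ q, ContinuousOn (fun x => σ x q) V) :
    (V × RootMu n P) ≃ₜ (C.rootMapLog n ⁻¹' V) where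
  toFun z := ⟨C.actLog z.2 (C.mkRootLog hn z.1 (σ z.1) (hσ z.1)), by
    rw [Set.mem_preimage, rootMapLog_actLog, rootMapLog_mkRootLog]
    exact z.1.2⟩
  invFun y := (⟨C.rootMapLog n y, y.2⟩, C.quotChar (σ (C.rootMapLog n y)) y (hσ _))
  left_inv := by
    rintro ⟨⟨x, hx⟩, χ⟩
    have h : C.rootMapLog n (C.actLog χ (C.mkRootLog hn x (σ x) (hσ x))) = x := by
      rw [rootMapLog_actLog, rootMapLog_mkRootLog]
    refine Prod.ext (Subtype.ext h) (RootMu.char_injective (MonoidHom.ext fun q => ?_))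
    refine (C.char_quotChar _ _ (hσ _) q).trans ?_
    rw [h, phase_actLog, phase_mkRootLog, mul_div_cancel_left,
      toUnits_unitPhase (RootMu.norm_char hn χ q)]
  right_inv := by
    rintro ⟨y, hy⟩
    refine Subtype.ext (C.rootLog_ext hn ?_ fun q => ?_)
    · rw [rootMapLog_actLog, rootMapLog_mkRootLog]
    · rw [phase_actLog, phase_mkRootLog, char_quotChar, unitPhase_toUnits, mul_div_cancel]
  continuous_toFun := by
    refine Continuous.subtype_mk (C.continuous_rootLog hn ?_ fun q => ?_) _
    · simp only [rootMapLog_actLog, rootMapLog_mkRootLog]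
      exact continuous_subtype_val.comp continuous_fst
    · simp only [phase_actLog, phase_mkRootLog]
      exact ((continuousOn_iff_continuous_domRestrict.1 (hσc q)).comp continuous_fst).mul
        (continuous_unitPhase.comp ((RootMu.continuous_char q).comp continuous_snd))
  continuous_invFun := by
    have h : Continuous fun y : C.rootMapLog n ⁻¹' V => (⟨C.rootMapLog n y, y.2⟩ : V) :=
      (C.continuous_rootMapLog.comp continuous_subtype_val).subtype_mk _
    refine h.prodMk (RootMu.continuous_of_char fun q => ?_)
    simp only [char_quotChar]
    refine continuous_toUnits.comp ?_
    exact (((C.rootChart n).continuous_phase q).comp continuous_subtype_val).div'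
      ((continuousOn_iff_continuous_domRestrict.1 (hσc q)).comp h)

lemma isPrincipalBundle_rootMapLog (hfg : AddMonoid.FG P)
    (hint : ∀ a b c : P, a + c = b + c → a = b)
    (hsat : ∀ (k : ℕ) (a b c : P), 0 < k → k • a = k • b + c → ∃ d : P, a = b + d)
    (hsharp : ∀ a b : P, a + b = 0 → a = 0) (hn : n ≠ 0) :
    IsPrincipalBundle (C.actLog (n := n)) (C.rootMapLog n) where
  one_act := C.actLog_one hn
  mul_act := C.actLog_mul hn
  continuous_act := C.continuous_actLog hn
  continuous_proj := C.continuous_rootMapLog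
  proj_act := C.rootMapLog_actLog
  locally_trivial x := by
    obtain ⟨V, hV, hx, σ, hσ, hσc⟩ := exists_local_root hfg hint hsat hsharp hn
      (fun x : C.Log => C.phase x) C.continuous_phase x
    have hσ' (x : C.Log) (p) : (σ x).comp (RootMonoid.num n P)
        ((RootMonoid.incl n P).toMultiplicative p) = C.phase x p := by
      rw [MonoidHom.comp_apply, RootMonoid.num_incl, map_pow, hσ]
    refine ⟨V, hV, hx, C.trivialization hn V (fun x => (σ x).comp (RootMonoid.num n P)) hσ'
      fun q => hσc _, fun v g => ?_, fun v g h => C.actLog_mul hn h g _⟩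
    exact (C.rootMapLog_actLog _ _).trans (C.rootMapLog_mkRootLog _ _ _ _)

end RootLog

end KatoChart

end

section Stacks

variable {G Y : Type} [Group G] [TopologicalSpace G] [TopologicalSpace Y] {actY : G → Y → Y}

/-- The pullback of a principal bundle. -/
lemma IsPrincipalBundle.pullback {E B T : Type} [TopologicalSpace E] [TopologicalSpace B]
    [TopologicalSpace T] {act : G → E → E} {π : E → B} (h : IsPrincipalBundle act π) {f : T → B}
    (hf : Continuous f) :
    IsPrincipalBundle (E := {x : T × E // f x.1 = π x.2})
      (fun g x => ⟨(x.1.1, act g x.1.2), x.2.trans (h.proj_act g _).symm⟩) (fun x => x.1.1) where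
  one_act x := Subtype.ext (Prod.ext rfl (h.one_act _))
  mul_act g k x := Subtype.ext (Prod.ext rfl (h.mul_act g k _))
  continuous_act := by
    have h1 : Continuous fun p : G × {x : T × E // f x.1 = π x.2} => p.2.1 :=
      continuous_subtype_val.comp continuous_snd
    exact ((continuous_fst.comp h1).prodMk
      (h.continuous_act.comp (continuous_fst.prodMk (continuous_snd.comp h1)))).subtype_mk _
  continuous_proj := continuous_fst.comp continuous_subtype_val
  proj_act _ _ := rfl
  locally_trivial b := by
    obtain ⟨V, hV, hb, t, ht, ht'⟩ := h.locally_trivial (f b)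
    let F (v : f ⁻¹' V) : V := ⟨f v, v.2⟩
    have hF : Continuous F := (hf.comp continuous_subtype_val).subtype_mk _
    have htc : Continuous fun z : V × G => (t z : E) := continuous_subtype_val.comp t.continuous
    let K (x : (fun x : {x : T × E // f x.1 = π x.2} => x.1.1) ⁻¹' (f ⁻¹' V)) : π ⁻¹' V :=
      ⟨x.1.1.2, by
        have := x.2
        simp only [Set.mem_preimage] at this ⊢
        rwa [← x.1.2]⟩
    have hK : Continuous K :=
      (continuous_snd.comp (continuous_subtype_val.comp continuous_subtype_val)).subtype_mk _
    refine ⟨f ⁻¹' V, hV.preimage hf, hb,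
      { toFun := fun z => ⟨⟨(z.1, t (F z.1, z.2)), (ht (F z.1) z.2).symm⟩, z.1.2⟩
        invFun := fun x => (⟨x.1.1.1, x.2⟩, (t.symm (K x)).2)
        left_inv := ?_
        right_inv := ?_
        continuous_toFun := ?_
        continuous_invFun := ?_ }, fun v g => rfl, fun v g k => ?_⟩
    · rintro ⟨v, g⟩
      refine Prod.ext rfl ?_
      change (t.symm (t (F v, g))).2 = g
      rw [t.symm_apply_apply]
    · intro x
      refine Subtype.ext (Subtype.ext (Prod.ext rfl ?_))
      have e : F ⟨x.1.1.1, x.2⟩ = (t.symm (K x)).1 := by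
        refine Subtype.ext ?_
        refine x.1.2.trans ?_
        have := ht (t.symm (K x)).1 (t.symm (K x)).2
        rwa [Prod.mk.eta, t.apply_symm_apply] at this
      change (t (F ⟨x.1.1.1, x.2⟩, (t.symm (K x)).2) : E) = x.1.1.2
      rw [e, Prod.mk.eta, t.apply_symm_apply]
    · exact (((continuous_subtype_val.comp continuous_fst).prodMk
        (htc.comp ((hF.comp continuous_fst).prodMk continuous_snd))).subtype_mk _).subtype_mk _
    · exact ((continuous_fst.comp (continuous_subtype_val.comp continuous_subtype_val)).subtype_mk
        _).prodMk (continuous_snd.comp (t.symm.continuous.comp hK))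
    · exact Subtype.ext (Prod.ext rfl (ht' (F v) g k))

namespace QuotientObj

/-- The pullback of an object of the quotient stack along a continuous map. -/
def pullback (A : QuotientObj actY) {T : TopCat.{0}} (f : T ⟶ A.base) : QuotientObj actY where
  base := T
  total := TopCat.of {x : T × A.total // f x.1 = A.proj x.2}
  act g x := ⟨(x.1.1, A.act g x.1.2), x.2.trans (A.bundle.proj_act g _).symm⟩
  proj x := x.1.1
  bundle := A.bundle.pullback f.hom.continuous
  toY x := A.toY x.1.2
  continuous_toY := A.continuous_toY.comp (continuous_snd.comp continuous_subtype_val)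
  toY_act g x := A.toY_act g x.1.2

/-- The morphism of stacks from a space to the quotient stack defined by an object over it. -/
def classifyingFunctor (A : QuotientObj actY) :
    BasedFunctor (spaceStack A.base) (quotientStack actY) where
  obj T := A.pullback (Over.hom (show Over A.base from T))
  map {T T'} k :=
    { base := Over.Hom.left (show (show Over A.base from T) ⟶ (show Over A.base from T') from k)
      total := TopCat.ofHom ⟨fun x => ⟨(Over.Hom.left
        (show (show Over A.base from T) ⟶ (show Over A.base from T') from k) x.1.1, x.1.2),
          (ConcreteCategory.congr_hom (Over.w
            (show (show Over A.base from T) ⟶ (show Over A.base from T') from k)) x.1.1).trans x.2⟩,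
        by
          refine Continuous.subtype_mk (Continuous.prodMk ?_ ?_) _
          · exact (TopCat.Hom.hom _).continuous.comp (continuous_fst.comp continuous_subtype_val)
          · exact continuous_snd.comp continuous_subtype_val⟩
      total_act := fun _ _ => rfl
      proj_total := fun _ => rfl
      toY_total := fun _ => rfl }
  map_id T := rfl
  map_comp f g := rfl
  w := rfl

/-- The universal object is the image of the identity. -/
def classifyingIso (A : QuotientObj actY) : A.pullback (𝟙 A.base) ≅ A where
  hom :=
    { base := 𝟙 _
      total := TopCat.ofHom ⟨fun x => x.1.2, continuous_snd.comp continuous_subtype_val⟩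
      total_act := fun _ _ => rfl
      proj_total := fun x => x.2.symm
      toY_total := fun _ => rfl }
  inv :=
    { base := 𝟙 _
      total := TopCat.ofHom ⟨fun x => ⟨(A.proj x, x), rfl⟩,
        (A.bundle.continuous_proj.prodMk continuous_id).subtype_mk _⟩
      total_act := fun g x => Subtype.ext (Prod.ext (A.bundle.proj_act g x) rfl)
      proj_total := fun _ => rfl
      toY_total := fun _ => rfl }
  hom_inv_id := QuotientHom.ext rfl (by
    ext x
    exact Subtype.ext (Prod.ext x.2.symm rfl))
  inv_hom_id := rfl

end QuotientObj

end Stacks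

end LogKN
open LogKN in
theorem mainTheorem9 (P : Type) [AddCommMonoid P]
    (hfg : AddMonoid.FG P)
    (hint : ∀ a b c : P, a + c = b + c → a = b)
    (hsat : ∀ (k : ℕ) (a b c : P), 0 < k → k • a = k • b + c → ∃ d : P, a = b + d)
    (hsharp : ∀ a b : P, a + b = 0 → a = 0)
    (X : LogScheme) (hX : LocallyOfFiniteType X.str) (C : KatoChart X P)
    (n : ℕ) (hn : 0 < n) :
    ((∀ x, C.actAn (n := n) 1 x = x) ∧
      (∀ (χ ψ : RootMu n P) (x : (C.root n).An), C.actAn (χ * ψ) x = C.actAn χ (C.actAn ψ x)) ∧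
      Continuous fun y : RootMu n P × (C.root n).An => C.actAn y.1 y.2) ∧
    ∃ (hφ : IsPrincipalBundle (C.actLog (n := n)) (C.rootMapLog n))
      (hτ : Continuous (C.rootChart n).toAn)
      (hτ' : ∀ (χ : RootMu n P) (y : (C.rootChart n).Log),
        (C.rootChart n).toAn (C.actLog χ y) = C.actAn χ ((C.rootChart n).toAn y)),
      ∃ (Φ : BasedFunctor (spaceStack (TopCat.of C.Log)) (C.rootStackTop n))
        (e : Φ.obj (Over.mk (𝟙 (TopCat.of C.Log)) : Over (TopCat.of C.Log)) ≅
          ({ base := TopCat.of C.Log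
             total := TopCat.of (C.rootChart n).Log
             act := C.actLog
             proj := C.rootMapLog n
             bundle := hφ
             toY := (C.rootChart n).toAn
             continuous_toY := hτ
             toY_act := hτ' } : QuotientObj (C.actAn (n := n)))),
        (C.rootStackTop n).p.IsHomLift (𝟙 (TopCat.of C.Log)) e.hom := by
  have hn' := Nat.pos_iff_ne_zero.1 hn
  have hφ := C.isPrincipalBundle_rootMapLog hfg hint hsat hsharp hn'
  have hτ := (C.rootChart n).continuous_toAn
  let A : QuotientObj (C.actAn (n := n)) :=
    { base := TopCat.of C.Log
      total := TopCat.of (C.rootChart n).Log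
      act := C.actLog
      proj := C.rootMapLog n
      bundle := hφ
      toY := (C.rootChart n).toAn
      continuous_toY := hτ
      toY_act := C.toAn_actLog }
  refine ⟨⟨C.actAn_one, C.actAn_mul, C.continuous_actAn⟩, hφ, hτ, C.toAn_actLog,
    A.classifyingFunctor, A.classifyingIso, ?_⟩
  exact Functor.IsHomLift.map (p := (C.rootStackTop n).p) A.classifyingIso.hom
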